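/- **Setting.** Let $\mathcal X\subset\mathbb R^p$, and for each $\mathbf x\in\mathcal X$ let $Y(\mathbf x)\ge 0$ be a random sales volume with distribution function $F_Y(\cdot\mid\mathbf x)$, density $f_Y(\cdot\mid\mathbf x)$ and quantile function $F_Y^{-1}(\tau\mid\mathbf x)=\inf\{y: F_Y(y\mid\mathbf x)\ge\tau\}$. Let $\mathbf x_1,\mathbf x_2,\ldots\in\mathcal X$ be fixed and let $y_1,y_2,\ldots$ be independent, $y_i$ having the law of $Y(\mathbf x_i)$. Assume: 1. $F_Y^{-1}(\tau\mid\mathbf x)=\boldsymbol\beta(\tau)^\top\mathbf x$ for all $\tau\in(0,1)$ and $\mathbf x\in\mathcal X$, where $\boldsymbol\beta$ is continuous on $(0,1)$. 2. The laws $F_Y(\cdot\mid\mathbf x)$, $\mathbf x\in\mathcal X$, are absolutely continuous with a common support, and for all $0<\tau_\ell<\tau_u<1$ both the infimum and the supremum of $f_Y(F_Y^{-1}(\tau\mid\mathbf x)\mid\mathbf x)$ over $\tau\in[\tau_\ell,\tau_u]$, $\mathbf x\in\mathcal X$ lie in $(0,\infty)$. 3. For all $0<\tau_\ell<\tau_u<1$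 there are positive definite matrices $D_0$ and $D_1(\tau)$, $\tau\in[\tau_\ell,\tau_u]$, with $\frac1n\sum_{i=1}^n\mathbf x_i\mathbf x_i^\top\to D_0$ and $\frac1n\sum_{i=1}^n f_Y(F_Y^{-1}(\tau\mid\mathbf x_i)\mid\mathbf x_i)\,\mathbf x_i\mathbf x_i^\top\to D_1(\tau)$ uniformly for $\tau\in[\tau_\ell,\tau_u]$; moreover $\max_{1\le i\le n}\|\mathbf x_i\|=o(\sqrt n)$. **QRGMM.** Let $m=m(n)$ be positive integers and $\tau_j=j/m$. For $1\le j\le m-1$ let the random vector $\hat{\boldsymbol\beta}(\tau_j)$ be a minimizer of $\mathbf b\mapsto\sum_{i=1}^n\rho_{\tau_j}(y_i-\mathbf b^\top\mathbf x_i)$, where $\rho_\tau(u)=(\tau-\mathbf 1\{u\le0\})u$, and put $\hat Q_{\tau_j}(\mathbf x)=\hat{\boldsymbol\beta}(\tau_j)^\top\mathbf x$. Let $U$ be uniform on $(0,1)$ and independent of the data, and let $\hat Y(\mathbf x)=\hat Q_{\tau_1}(\mathbf x)$ if $U<\tau_1$, $\hat Y(\mathbf x)=\hat Q_{\tau_{m-1}}(\mathbf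 x)$ if $U\ge\tau_{m-1}$, and $\hat Y(\mathbf x)=\hat Q_{\tau_j}(\mathbf x)+m(U-\tau_j)\bigl[\hat Q_{\tau_{j+1}}(\mathbf x)-\hat Q_{\tau_j}(\mathbf x)\bigr]$ if $U\in[\tau_j,\tau_{j+1})$, $1\le j\le m-2$. **Theorem.** Let $\mathbf x\in\mathcal X$, $r>0$, $\bar l\ge0$, and suppose that $\frac1m\to0$ and $\frac nm\to\infty$ as $n\to\infty$, and that the generated sales volume is nonnegative, $\hat Y(\mathbf x)\ge0$ almost surely, for all large $n$. Write $(z)^+=\max\{z,0\}$ and $r_2(l)=\mathbb E[(l-rY(\mathbf x))^+]$. Then the expected losses exist (for all large $n$), and $$\sup_{l\in[0,\bar l]}\bigl|\hat r_2(l)-r_2(l)\bigr|\to0\qquad(n\to\infty)$$ in both of the following senses: deterministically, for $\hat r_2(l)=\mathbb E[(l-r\hat Y(\mathbf x))^+]$ with the expectation over the data and $U$; and in probability, for $\hat r_2(l)=\mathbb E[(l-r\hat Y(\mathbf x))^+\mid y_1,\ldots,y_n,\hat{\boldsymbol\beta}(\tau_1),\ldots,\hat{\boldsymbol\beta}(\tau_{m-1})]$,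 the expected loss under the fitted generator. -/

import Mathlib

open MeasureTheory ProbabilityTheory Filter Topology
open scoped ENNReal

noncomputable section

namespace QRGMM

/-- Covariate (and coefficient) vectors in Euclidean space. -/
abbrev Vec (p : ℕ) : Type := EuclideanSpace ℝ (Fin p)

/-- The quantile function (generalized inverse of the distribution function) of a law on the
real line, `F⁻¹(τ) = inf {y | τ ≤ F y}`. -/
def quantile (μ : Measure ℝ) (τ : ℝ) : ℝ := sInf {y : ℝ | τ ≤ cdf μ y}

/-- The pinball loss `ρ_τ(u) = (τ - 1{u ≤ 0}) u`. -/
def pinball (τ u : ℝ) : ℝ := (τ - if u ≤ 0 then 1 else 0) * u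

/-- `b` is a minimizer of the linear quantile regression problem of level `τ` on the `n` data
points `(x i, y i)`, `i < n`. -/
def IsQuantileRegressionFit {p : ℕ} (n : ℕ) (x : ℕ → Vec p) (y : ℕ → ℝ) (τ : ℝ)
    (b : Vec p) : Prop :=
  ∀ b' : Vec p,
    ∑ i ∈ Finset.range n, pinball τ (y i - inner ℝ b (x i)) ≤
      ∑ i ∈ Finset.range n, pinball τ (y i - inner ℝ b' (x i))

/-- Piecewise linear interpolation of the values `q j` at the grid points `j / m`, for
`j = 1, …, m - 1`, constant to the left of `1 / m` and to the right of `(m - 1) / m`.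
For `u` in `[j / m, (j + 1) / m)` one has `⌊m u⌋ = j`. -/
def interpolate (m : ℕ) (q : ℕ → ℝ) (u : ℝ) : ℝ :=
  if u < 1 / (m : ℝ) then q 1
  else if ((m : ℝ) - 1) / m ≤ u then q (m - 1)
  else q ⌊(m : ℝ) * u⌋₊ +
    m * (u - (⌊(m : ℝ) * u⌋₊ : ℝ) / m) * (q (⌊(m : ℝ) * u⌋₊ + 1) - q ⌊(m : ℝ) * u⌋₊)

/-- The output of the generator at the covariate vector `x` for the uniform input `u`, when the
fitted coefficient vectors at the levels `j / m` are `b j`. -/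
def generate {p : ℕ} (m : ℕ) (b : ℕ → Vec p) (x : Vec p) (u : ℝ) : ℝ :=
  interpolate m (fun j => inner ℝ (b j) x) u

/-- The uniform distribution on `(0, 1)`. -/
def uniform01 : Measure ℝ := volume.restrict (Set.Ioo 0 1)

/-- The shortfall `(l - r y)⁺` of a loan `l` when the sales volume is `y`. -/
def loss (r l y : ℝ) : ℝ := max (l - r * y) 0

/-- The expected loss `E[(l - r Y)⁺]` of a random variable `Y` on `(α, μ)`. -/
def expectedLoss {α : Type*} [MeasurableSpace α] (μ : Measure α) (Y : α → ℝ) (r l : ℝ) : ℝ :=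
  ∫ a, loss r l (Y a) ∂μ

/-- The conditional quantiles are linear in the covariates, with coefficients that are
continuous in the level. -/
def LinearQuantiles {p : ℕ} (X : Set (Vec p)) (law : Vec p → Measure ℝ) : Prop :=
  ∃ β : ℝ → Vec p, ContinuousOn β (Set.Ioo 0 1) ∧
    ∀ x ∈ X, ∀ τ ∈ Set.Ioo (0 : ℝ) 1, quantile (law x) τ = inner ℝ (β τ) x

/-- `f x` is a probability density (a fixed version) of the law of the response at `x`. -/
def HasDensities {p : ℕ} (X : Set (Vec p)) (law : Vec p → Measure ℝ)
    (f : Vec p → ℝ → ℝ) : Prop :=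
  ∀ x ∈ X, Measurable (f x) ∧ (∀ y, 0 ≤ f x y) ∧
    law x = volume.withDensity (fun y => ENNReal.ofReal (f x y))

/-- The conditional laws are absolutely continuous with a common support, and on every compact
range of levels inside `(0, 1)` the densities at the quantiles are bounded away from zero and
infinity, uniformly over the covariates. -/
def RegularDensities {p : ℕ} (X : Set (Vec p)) (law : Vec p → Measure ℝ)
    (f : Vec p → ℝ → ℝ) : Prop :=
  HasDensities X law f ∧
  (∃ S : Set ℝ, ∀ x ∈ X, (law x).support = S) ∧
  ∀ τl τu : ℝ, 0 < τl → τl < τu → τu < 1 →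
    (0 < ⨅ τ ∈ Set.Icc τl τu, ⨅ x ∈ X, ENNReal.ofReal (f x (quantile (law x) τ))) ∧
    (⨅ τ ∈ Set.Icc τl τu, ⨅ x ∈ X, ENNReal.ofReal (f x (quantile (law x) τ))) < ∞ ∧
    (0 < ⨆ τ ∈ Set.Icc τl τu, ⨆ x ∈ X, ENNReal.ofReal (f x (quantile (law x) τ))) ∧
    (⨆ τ ∈ Set.Icc τl τu, ⨆ x ∈ X, ENNReal.ofReal (f x (quantile (law x) τ))) < ∞

/-- Regularity of the design `x 0, x 1, …`: convergence of the Gram matrices, and of the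
density-weighted Gram matrices (uniformly on compact ranges of levels), to positive definite
limits, and `max_{i < n} ‖x i‖ = o(√n)`. Matrix limits are written entrywise. -/
def RegularDesign {p : ℕ} (law : Vec p → Measure ℝ) (f : Vec p → ℝ → ℝ)
    (x : ℕ → Vec p) : Prop :=
  (∀ τl τu : ℝ, 0 < τl → τl < τu → τu < 1 →
    ∃ (D₀ : Matrix (Fin p) (Fin p) ℝ) (D₁ : ℝ → Matrix (Fin p) (Fin p) ℝ),
      D₀.PosDef ∧ (∀ τ ∈ Set.Icc τl τu, (D₁ τ).PosDef) ∧
      (∀ a b : Fin p, Tendsto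
        (fun n : ℕ => 1 / (n : ℝ) * ∑ i ∈ Finset.range n, x i a * x i b)
        atTop (𝓝 (D₀ a b))) ∧
      (∀ a b : Fin p, TendstoUniformlyOn
        (fun (n : ℕ) (τ : ℝ) => 1 / (n : ℝ) *
          ∑ i ∈ Finset.range n, f (x i) (quantile (law (x i)) τ) * (x i a * x i b))
        (fun τ => D₁ τ a b) atTop (Set.Icc τl τu))) ∧
  Asymptotics.IsLittleO atTop (fun n : ℕ => ⨆ i : Fin n, ‖x i‖) (fun n : ℕ => √(n : ℝ))

end QRGMM

end

/-! The proof couples the generator with the true law: fed with the same uniform `U`, the quantile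
function returns a variable with law `law x`. Nonnegative outputs have losses in `[0, l]`, and the
loss is `r`-Lipschitz, so for every `l` at once the loss error is at most `min lbar (r * |Ŷ -
Q(U)|)`. It suffices that the mean of this bounded quantity tends to `0`; Markov's inequality then
gives the conditional statement. By Fubini and dominated convergence in `u`, convergence in
probability at each fixed level `u` is enough, so neither extreme levels nor joint control over the
grid matter. At fixed `u` the output lies between the fits at two grid levels tending to `u`.

The core is `measure_lt_norm_fit_sub_le`, a deviation bound for one fit. By convexity, a fit farther
than `ρ` from `β` makes the objective increment nonpositive somewhere on the sphere of radius `ρ`.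
`le_pinball_sub` bounds the increment below using a window around the quantile that does not depend
on the direction. The window has known probability, which yields a quadratic drift governed by the
Gram matrix. The remainder consists of centred sums; expanding in coordinates leaves finitely many
scalar sums, controlled by variances, so no empirical process theory is needed. -/

noncomputable section

namespace QRGMM

/-! ### Quantile functions of atomless laws. -/

section Quantile

variable {μ : Measure ℝ} [IsProbabilityMeasure μ]

theorem continuous_cdf [NullSingletonClass μ] : Continuous (cdf μ) := by
  rw [continuous_iff_continuousAt]
  intro y
  rw [(monotone_cdf μ).continuousAt_iff_leftLim_eq_rightLim,
    (cdf μ).rightLim_eq]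
  have h := (cdf μ).measure_singleton y
  rw [measure_cdf, measure_singleton] at h
  have h1 := (monotone_cdf μ).leftLim_le (le_refl y)
  have h2 := ENNReal.ofReal_eq_zero.1 h.symm
  linarith

/-- Continuity of the distribution function closes the superlevel set, so the infimum is attained.
-/
theorem quantile_le_iff [NullSingletonClass μ] {τ : ℝ} (hτ : τ ∈ Set.Ioo (0 : ℝ) 1) (y : ℝ) :
    quantile μ τ ≤ y ↔ τ ≤ cdf μ y := by
  have hne : {y : ℝ | τ ≤ cdf μ y}.Nonempty :=
    (((tendsto_cdf_atTop μ).eventually (eventually_ge_nhds hτ.2))).exists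
  obtain ⟨a, ha⟩ := ((tendsto_cdf_atBot μ).eventually (eventually_lt_nhds hτ.1)).exists
  have hbdd : BddBelow {y : ℝ | τ ≤ cdf μ y} := by
    refine ⟨a, fun y hy => ?_⟩
    by_contra! h
    exact absurd (lt_of_le_of_lt (hy.out.trans (monotone_cdf μ h.le)) ha) (lt_irrefl _)
  have hcl : IsClosed {y : ℝ | τ ≤ cdf μ y} := isClosed_le continuous_const continuous_cdf
  refine ⟨fun h => ?_, fun h => csInf_le hbdd h⟩
  exact (hcl.csInf_mem hne hbdd).out.trans (monotone_cdf μ h)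

theorem cdf_quantile [NullSingletonClass μ] {τ : ℝ} (hτ : τ ∈ Set.Ioo (0 : ℝ) 1) :
    cdf μ (quantile μ τ) = τ := by
  refine le_antisymm ?_ ((quantile_le_iff hτ _).1 le_rfl)
  have hlim : Tendsto (cdf μ) (𝓝[<] quantile μ τ) (𝓝 (cdf μ (quantile μ τ))) :=
    (continuous_cdf.tendsto _).mono_left nhdsWithin_le_nhds
  refine le_of_tendsto hlim ?_
  filter_upwards [self_mem_nhdsWithin] with y hy
  by_contra! h
  exact absurd ((quantile_le_iff hτ y).2 h.le) (not_le.2 hy)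

theorem quantile_monotoneOn [NullSingletonClass μ] : MonotoneOn (quantile μ) (Set.Ioo 0 1) := by
  intro s hs t ht hst
  rw [quantile_le_iff hs, cdf_quantile ht]
  exact hst

theorem measureReal_Iic_quantile [NullSingletonClass μ] {τ : ℝ} (hτ : τ ∈ Set.Ioo (0 : ℝ) 1) :
    μ.real (Set.Iic (quantile μ τ)) = τ := by
  rw [← cdf_eq_real, cdf_quantile hτ]

theorem measureReal_Ioc_quantile [NullSingletonClass μ] {s t : ℝ} (hs : s ∈ Set.Ioo (0 : ℝ) 1)
    (ht : t ∈ Set.Ioo (0 : ℝ) 1) (hst : s ≤ t) :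
    μ.real (Set.Ioc (quantile μ s) (quantile μ t)) = t - s := by
  rw [← Set.Iic_sdiff_Iic, measureReal_sdiff (Set.Iic_subset_Iic.2 (quantile_monotoneOn hs ht hst))
    measurableSet_Iic, measureReal_Iic_quantile hs, measureReal_Iic_quantile ht]

instance : IsProbabilityMeasure uniform01 := ⟨by simp [uniform01]⟩

theorem aemeasurable_quantile [NullSingletonClass μ] : AEMeasurable (quantile μ) uniform01 :=
  aemeasurable_restrict_of_monotoneOn measurableSet_Ioo quantile_monotoneOn

/-- Inverse transform sampling, the source of the coupling: on `(0, 1)`, the quantile is at most `y`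
exactly when the level is at most `cdf μ y`. -/
theorem map_quantile [NullSingletonClass μ] : uniform01.map (quantile μ) = μ := by
  have := Measure.isProbabilityMeasure_map (μ := uniform01) (aemeasurable_quantile (μ := μ))
  refine Measure.eq_of_cdf _ _ ?_
  ext y
  rw [cdf_eq_real, map_measureReal_apply_of_aemeasurable aemeasurable_quantile measurableSet_Iic]
  have h : quantile μ ⁻¹' Set.Iic y =ᵐ[uniform01] Set.Iic (cdf μ y) := by
    filter_upwards [ae_restrict_mem measurableSet_Ioo] with τ hτ
    exact propext (quantile_le_iff hτ y)
  rw [measureReal_congr h, uniform01, restrict_Ioo_eq_restrict_Ioc,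
    measureReal_restrict_apply measurableSet_Iic, Set.inter_comm, Set.Ioc_inter_Iic,
    Real.volume_real_Ioc, min_eq_right (cdf_le_one μ y), sub_zero,
    max_eq_left (cdf_nonneg μ y)]

/-- If the density at the quantiles of levels in `[s, t]` is at least `c`, and the quantile
function is continuous there, then its slope is at most `1 / c`. -/
theorem mul_quantile_sub_le [NullSingletonClass μ] {g : ℝ → ℝ} (hg : Measurable g)
    (hμ : μ = volume.withDensity fun y => ENNReal.ofReal (g y))
    {s t c : ℝ} (hc : 0 ≤ c) (hs : s ∈ Set.Ioo (0 : ℝ) 1) (ht : t ∈ Set.Ioo (0 : ℝ) 1)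
    (hst : s ≤ t) (hcont : ContinuousOn (quantile μ) (Set.Icc s t))
    (hlow : ∀ τ ∈ Set.Icc s t, c ≤ g (quantile μ τ)) :
    c * (quantile μ t - quantile μ s) ≤ t - s := by
  have hmono := quantile_monotoneOn (μ := μ) hs ht hst
  have h : ENNReal.ofReal (c * (quantile μ t - quantile μ s)) ≤
      μ (Set.Ioc (quantile μ s) (quantile μ t)) := by
    rw [congrArg (fun ν : Measure ℝ => ν (Set.Ioc (quantile μ s) (quantile μ t))) hμ,
      withDensity_apply _ measurableSet_Ioc, ENNReal.ofReal_mul hc, ← Real.volume_Ioc,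
      ← setLIntegral_const]
    refine setLIntegral_mono hg.ennreal_ofReal fun y hy => ?_
    -- Continuity makes every point of the interval a quantile, so the density bound holds
    -- throughout it.
    obtain ⟨τ, hτ, rfl⟩ := intermediate_value_Icc hst hcont (Set.Ioc_subset_Icc_self hy)
    exact ENNReal.ofReal_le_ofReal (hlow τ hτ)
  rw [← measureReal_Ioc_quantile (μ := μ) hs ht hst]
  exact (ENNReal.ofReal_le_iff_le_toReal (measure_ne_top _ _)).1 h

end Quantile

/-! ### Convexity and quadratic growth of the pinball loss. -/

section Pinball

theorem pinball_eq (t u : ℝ) : pinball t u = |u| / 2 + (t - 1 / 2) * u := by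
  unfold pinball
  split_ifs with h
  · rw [abs_of_nonpos h]; ring
  · rw [abs_of_pos (not_le.1 h)]; ring

/-- Convexity of the pinball loss along a ray. -/
theorem pinball_sub_mul_le (t e v : ℝ) {s : ℝ} (h0 : 0 ≤ s) (h1 : s ≤ 1) :
    pinball t (e - s * v) - pinball t e ≤ s * (pinball t (e - v) - pinball t e) := by
  simp only [pinball_eq]
  have h : |e - s * v| ≤ (1 - s) * |e| + s * |e - v| := by
    calc |e - s * v| = |(1 - s) * e + s * (e - v)| := by ring_nf
      _ ≤ |(1 - s) * e| + |s * (e - v)| := abs_add_le _ _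
      _ = (1 - s) * |e| + s * |e - v| := by
        rw [abs_mul, abs_mul, abs_of_nonneg h0, abs_of_nonneg (sub_nonneg.2 h1)]
  linarith

/-- The indicator of the response lying between two levels `a ≤ b`. -/
def window (a b y : ℝ) : ℝ := (Set.Ioc a b).indicator 1 y

/-- The subgradient of the pinball loss, averaged over the window `(a, b]`. -/
def score (t a b y : ℝ) : ℝ := t - window a b y / 2 - (Set.Iic a).indicator 1 y

theorem measurable_window (a b : ℝ) : Measurable (window a b) :=
  measurable_one.indicator measurableSet_Ioc

theorem measurable_score (t a b : ℝ) : Measurable (score t a b) :=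
  ((measurable_const.sub ((measurable_window a b).div_const 2))).sub
    (measurable_one.indicator measurableSet_Iic)

theorem window_cases (a b y : ℝ) : window a b y = 0 ∨ window a b y = 1 := by
  by_cases h : y ∈ Set.Ioc a b <;> simp [window, h]

theorem abs_score_le {t : ℝ} (h0 : 0 ≤ t) (h1 : t ≤ 1) (a b y : ℝ) : |score t a b y| ≤ 1 := by
  rw [abs_le]
  by_cases ha : y ≤ a
  · have : y ∉ Set.Ioc a b := fun h => absurd ha (not_le.2 h.1)
    simp only [score, window, Set.indicator_of_notMem this, Set.mem_Iic, ha, Set.indicator_of_mem,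
      Pi.one_apply]
    constructor <;> linarith
  · rcases window_cases a b y with h | h <;>
    simp only [score, h, Set.mem_Iic, ha, not_false_eq_true, Set.indicator_of_notMem] <;>
    constructor <;> linarith

/-- A lower bound for the increment of the pinball loss that is quadratic in the
increment `v` on a window around the quantile `Q`. -/
theorem le_pinball_sub {t a b Q V d v y : ℝ} (haQ : a ≤ Q) (hQb : Q ≤ b)
    (ha : Q - d ≤ a) (hb : b ≤ Q + d) (hv : |v| ≤ V) :
    window a b y * (v ^ 2 / (2 * V) - d) - score t a b y * v ≤
      pinball t (y - Q - v) - pinball t (y - Q) := by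
  have hlin : v ≤ |y - Q| + |y - Q - v| := by
    have := le_abs_self (y - Q); have := neg_abs_le (y - Q - v); linarith
  have hlin' : -v ≤ |y - Q| + |y - Q - v| := by
    have := neg_abs_le (y - Q); have := le_abs_self (y - Q - v); linarith
  -- Outside the window the loss is bounded below by a tangent line. Inside, `|y - Q| ≤ d` leaves a
  -- gain of at least `|v| / 2 - d` over the line of slope `t - 1 / 2`.
  by_cases hy : y ∈ Set.Ioc a b
  · have hya : ¬ y ≤ a := not_le.2 hy.1
    have hd : |y - Q| ≤ d := abs_le.2 ⟨by linarith [hy.1], by linarith [hy.2]⟩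
    -- A quadratic replaces the absolute value so that summing over the data produces a quadratic
    -- form in the direction.
    have hq : v ^ 2 / (2 * V) ≤ |v| / 2 := by
      rcases (abs_nonneg v).eq_or_lt with h | h
      · rw [← sq_abs, ← h]; simp
      · rw [div_le_div_iff₀ (by linarith) two_pos, ← sq_abs]
        nlinarith
    have hab : |v| ≤ |y - Q| + |y - Q - v| := abs_le'.2 ⟨hlin, hlin'⟩
    simp only [score, window, hy, Set.indicator_of_mem, Pi.one_apply, Set.mem_Iic, hya,
      not_false_eq_true, Set.indicator_of_notMem, pinball_eq]
    linarith
  · rcases le_or_gt y a with h | h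
    · simp only [score, window, hy, Set.indicator_of_mem, Pi.one_apply, Set.mem_Iic, h,
        not_false_eq_true, Set.indicator_of_notMem, pinball_eq, abs_of_nonpos (a := y - Q)
        (by linarith)]
      have := neg_abs_le (y - Q - v)
      linarith
    · have hyb : b < y := by by_contra! h'; exact hy ⟨h, h'⟩
      simp only [score, window, hy, Set.mem_Iic, not_le.2 h,
        not_false_eq_true, Set.indicator_of_notMem, pinball_eq, abs_of_nonneg (a := y - Q)
        (by linarith)]
      have := le_abs_self (y - Q - v)
      linarith

variable {p : ℕ}

/-- A fit at distance more than `ρ` from `β` yields a direction in which the increment of the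
objective at distance `ρ` from `β` is nonpositive. -/
theorem IsQuantileRegressionFit.exists_direction {n : ℕ} {x : ℕ → Vec p} {y : ℕ → ℝ} {t : ℝ}
    {b : Vec p} (hb : IsQuantileRegressionFit n x y t b) (β : Vec p) {ρ : ℝ} (hρ : 0 ≤ ρ)
    (h : ρ < ‖b - β‖) :
    ∃ e : Vec p, ‖e‖ = 1 ∧
      ∑ i ∈ Finset.range n, (pinball t (y i - inner ℝ β (x i) - ρ * inner ℝ e (x i)) -
        pinball t (y i - inner ℝ β (x i))) ≤ 0 := by
  have hpos : 0 < ‖b - β‖ := hρ.trans_lt h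
  refine ⟨‖b - β‖⁻¹ • (b - β), by rw [norm_smul, norm_inv, norm_norm, inv_mul_cancel₀ hpos.ne'],
    ?_⟩
  have key : ∀ i, pinball t (y i - inner ℝ β (x i) -
      ρ * inner ℝ (‖b - β‖⁻¹ • (b - β)) (x i)) - pinball t (y i - inner ℝ β (x i)) ≤
      (ρ * ‖b - β‖⁻¹) * (pinball t (y i - inner ℝ b (x i)) -
        pinball t (y i - inner ℝ β (x i))) := by
    intro i
    have := pinball_sub_mul_le t (y i - inner ℝ β (x i)) (inner ℝ (b - β) (x i))
      (s := ρ * ‖b - β‖⁻¹) (by positivity) (by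
        rw [← div_eq_mul_inv, div_le_one hpos]; exact h.le)
    rw [real_inner_smul_left, ← mul_assoc]
    refine this.trans (le_of_eq ?_)
    rw [inner_sub_left, sub_sub, add_sub_cancel]
  refine (Finset.sum_le_sum fun i _ => key i).trans ?_
  rw [← Finset.mul_sum, Finset.sum_sub_distrib]
  exact mul_nonpos_of_nonneg_of_nonpos (by positivity) (sub_nonpos.2 (hb β))

end Pinball

/-! ### Mean absolute value of weighted centred sums. -/

section Noise

variable {Ω : Type*} [MeasurableSpace Ω] {P : Measure Ω} [IsProbabilityMeasure P]

theorem integral_abs_sum_le {a : ℕ → Ω → ℝ} (hm : ∀ i, Measurable (a i))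
    (hind : iIndepFun a P) {n : ℕ} (hbd : ∀ i ∈ Finset.range n, ∀ ω, |a i ω| ≤ 1)
    (hmean : ∀ i ∈ Finset.range n, ∫ ω, a i ω ∂P = 0) (w : ℕ → ℝ) :
    ∫ ω, |∑ i ∈ Finset.range n, a i ω * w i| ∂P ≤ √(∑ i ∈ Finset.range n, w i ^ 2) := by
  have hmem : ∀ i ∈ Finset.range n, MemLp (fun ω => a i ω * w i) 2 P := fun i hi =>
    MemLp.of_bound ((hm i).mul_const _).aestronglyMeasurable |w i| (ae_of_all _ fun ω => by
      rw [Real.norm_eq_abs, abs_mul]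
      exact mul_le_of_le_one_left (abs_nonneg _) (hbd i hi ω))
  have hvar : ∀ i ∈ Finset.range n, variance (fun ω => a i ω * w i) P ≤ w i ^ 2 := by
    intro i hi
    refine (variance_le_expectation_sq (hmem i hi).aestronglyMeasurable).trans ?_
    have := integral_mono (μ := P) (f := fun ω => (a i ω * w i) ^ 2) (g := fun _ => w i ^ 2)
      (hmem i hi).integrable_sq (integrable_const _) (fun ω => by
        simp only [mul_pow]
        refine mul_le_of_le_one_left (sq_nonneg _) ?_
        exact (sq_le_one_iff_abs_le_one _).2 (hbd i hi ω))
    simpa using this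
  have hsum := IndepFun.variance_sum (s := Finset.range n) hmem
    (fun i _ j _ hij => (hind.indepFun hij).comp (φ := fun z => z * w i)
      (ψ := fun z => z * w j) (measurable_id.mul_const _) (measurable_id.mul_const _))
  have hS : MemLp (∑ i ∈ Finset.range n, fun ω => a i ω * w i) 2 P :=
    memLp_finsetSum' _ hmem
  have h0 : ∫ ω, (∑ i ∈ Finset.range n, fun ω => a i ω * w i) ω ∂P = 0 := by
    simp only [Finset.sum_apply]
    rw [integral_finsetSum _ fun i hi => (hmem i hi).integrable (by norm_num)]
    exact Finset.sum_eq_zero fun i hi => by rw [integral_mul_const, hmean i hi, zero_mul]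
  have hsq : ∫ ω, (∑ i ∈ Finset.range n, a i ω * w i) ^ 2 ∂P ≤ ∑ i ∈ Finset.range n, w i ^ 2 := by
    have := variance_eq_sub hS
    rw [h0] at this
    have h2 : ∫ ω, (∑ i ∈ Finset.range n, a i ω * w i) ^ 2 ∂P =
        ∑ i ∈ Finset.range n, variance (fun ω => a i ω * w i) P := by
      rw [← hsum, this]; simp
    rw [h2]
    exact Finset.sum_le_sum hvar
  -- Nonnegativity of the variance of `|S|` is the inequality `(E|S|)² ≤ E S²`.
  have habs := variance_eq_sub hS.norm
  have hnn := variance_nonneg (fun ω => ‖(∑ i ∈ Finset.range n, fun ω => a i ω * w i) ω‖) P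
  refine Real.le_sqrt_of_sq_le (le_trans ?_ hsq)
  rw [habs] at hnn
  simpa using hnn

end Noise

/-! ### Linear and quadratic forms of the design. -/

section Design

variable {p : ℕ}

theorem inner_eq_sum (e x : Vec p) : inner ℝ e x = ∑ a, e a * x a := by
  simp [PiLp.inner_apply, mul_comm]

theorem abs_apply_le_norm (e : Vec p) (a : Fin p) : |e a| ≤ ‖e‖ := by
  simpa using PiLp.norm_apply_le e a

/-- Coordinates of a unit vector are at most `1` in absolute value. The right side is free of `e`,
which matters because the direction depends on the data. -/
theorem abs_sum_mul_inner_le {e : Vec p} (he : ‖e‖ = 1) (s : ℕ → ℝ) (x : ℕ → Vec p) (n : ℕ) :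
    |∑ i ∈ Finset.range n, s i * inner ℝ e (x i)| ≤
      ∑ a, |∑ i ∈ Finset.range n, s i * x i a| := by
  have h : ∑ i ∈ Finset.range n, s i * inner ℝ e (x i) =
      ∑ a, e a * ∑ i ∈ Finset.range n, s i * x i a := by
    simp only [inner_eq_sum, Finset.mul_sum]
    rw [Finset.sum_comm]
    exact Finset.sum_congr rfl fun a _ => Finset.sum_congr rfl fun i _ => by ring
  rw [h]
  refine (Finset.abs_sum_le_sum_abs _ _).trans (Finset.sum_le_sum fun a _ => ?_)
  rw [abs_mul]
  exact mul_le_of_le_one_left (abs_nonneg _) ((abs_apply_le_norm e a).trans he.le)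

theorem sum_mul_inner_sq (e : Vec p) (s : ℕ → ℝ) (x : ℕ → Vec p) (n : ℕ) :
    ∑ i ∈ Finset.range n, s i * inner ℝ e (x i) ^ 2 =
      ∑ a, ∑ b, e a * e b * ∑ i ∈ Finset.range n, s i * (x i a * x i b) := by
  have h : ∀ i, s i * inner ℝ e (x i) ^ 2 = ∑ a, ∑ b, e a * e b * (s i * (x i a * x i b)) := by
    intro i
    rw [inner_eq_sum, sq, Finset.sum_mul_sum, Finset.mul_sum]
    refine Finset.sum_congr rfl fun a _ => ?_
    rw [Finset.mul_sum]
    exact Finset.sum_congr rfl fun b _ => by ring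
  simp only [h]
  rw [Finset.sum_comm]
  refine Finset.sum_congr rfl fun a _ => ?_
  rw [Finset.sum_comm]
  exact Finset.sum_congr rfl fun b _ => (Finset.mul_sum _ _ _).symm

theorem abs_quadratic_le {e : Vec p} (he : ‖e‖ = 1) (M : Fin p → Fin p → ℝ) :
    |∑ a, ∑ b, e a * e b * M a b| ≤ ∑ a, ∑ b, |M a b| := by
  refine (Finset.abs_sum_le_sum_abs _ _).trans (Finset.sum_le_sum fun a _ => ?_)
  refine (Finset.abs_sum_le_sum_abs _ _).trans (Finset.sum_le_sum fun b _ => ?_)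
  rw [abs_mul, abs_mul]
  refine mul_le_of_le_one_left (abs_nonneg _) ?_
  exact mul_le_one₀ ((abs_apply_le_norm e a).trans he.le) (abs_nonneg _)
    ((abs_apply_le_norm e b).trans he.le)

/-- Compactness of the unit sphere; the sphere is empty when `p = 0`, and any positive constant then
serves. -/
theorem exists_quadratic_lower_bound {D : Matrix (Fin p) (Fin p) ℝ} (hD : D.PosDef) :
    ∃ lam : ℝ, 0 < lam ∧ ∀ e : Vec p, ‖e‖ = 1 → lam ≤ ∑ a, ∑ b, e a * e b * D a b := by
  have hpos : ∀ e : Vec p, ‖e‖ = 1 → 0 < ∑ a, ∑ b, e a * e b * D a b := by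
    intro e he
    have hne : (fun a => e a) ≠ 0 := by
      intro h
      have : e = 0 := by ext a; exact congrFun h a
      simp [this] at he
    have := hD.dotProduct_mulVec_pos hne
    simp only [dotProduct, Matrix.mulVec, Pi.star_apply, star_trivial, Finset.mul_sum] at this
    refine this.trans_eq (Finset.sum_congr rfl fun a _ => Finset.sum_congr rfl fun b _ => by ring)
  have hcont : Continuous fun e : Vec p => ∑ a, ∑ b, e a * e b * D a b := by fun_prop
  rcases (Metric.sphere (0 : Vec p) 1).eq_empty_or_nonempty with h | h
  · refine ⟨1, one_pos, fun e he => ?_⟩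
    have : e ∈ Metric.sphere (0 : Vec p) 1 := by simpa using he
    simp [h] at this
  · obtain ⟨e₀, he₀, hmin⟩ := (isCompact_sphere (0 : Vec p) 1).exists_isMinOn h hcont.continuousOn
    exact ⟨_, hpos e₀ (by simpa using he₀), fun e he => hmin (by simpa using he)⟩

/-- Convergence of the Gram matrices to a positive definite limit bounds their trace, and bounds
their quadratic forms from below. -/
theorem eventually_gram_bounds {D : Matrix (Fin p) (Fin p) ℝ} (hD : D.PosDef) {x : ℕ → Vec p}
    (hlim : ∀ a b : Fin p, Tendsto
      (fun n : ℕ => 1 / (n : ℝ) * ∑ i ∈ Finset.range n, x i a * x i b) atTop (𝓝 (D a b))) :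
    ∃ lam T : ℝ, 0 < lam ∧ lam ≤ T ∧ ∀ᶠ n : ℕ in atTop,
      ∑ i ∈ Finset.range n, ‖x i‖ ^ 2 ≤ n * T ∧
      ∀ e : Vec p, ‖e‖ = 1 → n * lam ≤ ∑ i ∈ Finset.range n, inner ℝ e (x i) ^ 2 := by
  obtain ⟨lam, hlam, hlow⟩ := exists_quadratic_lower_bound hD
  have htr : Tendsto (fun n : ℕ => ∑ a, 1 / (n : ℝ) * ∑ i ∈ Finset.range n, x i a * x i a) atTop
      (𝓝 (∑ a, D a a)) := tendsto_finsetSum _ fun a _ => hlim a a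
  have hdiff : Tendsto (fun n : ℕ => ∑ a, ∑ b,
      |1 / (n : ℝ) * ∑ i ∈ Finset.range n, x i a * x i b - D a b|) atTop (𝓝 0) := by
    have : Tendsto (fun n : ℕ => ∑ a, ∑ b,
        |1 / (n : ℝ) * ∑ i ∈ Finset.range n, x i a * x i b - D a b|) atTop
        (𝓝 (∑ a, ∑ b, |D a b - D a b|)) :=
      tendsto_finsetSum _ fun a _ => tendsto_finsetSum _ fun b _ =>
        ((hlim a b).sub_const _).abs
    simpa using this
  -- The maximum secures `lam ≤ T`, needed later for `η ≤ 1`.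
  refine ⟨lam / 2, max (lam / 2) (∑ a, D a a + 1), by positivity, le_max_left _ _, ?_⟩
  filter_upwards [htr.eventually_le_const (lt_add_one _),
    hdiff.eventually_le_const (half_pos hlam), eventually_gt_atTop 0] with n h1 h2 hn
  have hn' : (0 : ℝ) < n := Nat.cast_pos.2 hn
  constructor
  · have hs : ∑ i ∈ Finset.range n, ‖x i‖ ^ 2 =
        n * ∑ a, 1 / (n : ℝ) * ∑ i ∈ Finset.range n, x i a * x i a := by
      rw [← Finset.mul_sum, Finset.sum_comm, ← mul_assoc, mul_one_div_cancel hn'.ne', one_mul]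
      exact Finset.sum_congr rfl fun i _ => by
        rw [EuclideanSpace.real_norm_sq_eq]
        exact Finset.sum_congr rfl fun a _ => by ring
    rw [hs]
    exact mul_le_mul_of_nonneg_left (h1.trans (le_max_right _ _)) hn'.le
  · intro e he
    have h3 := (abs_le.1 ((abs_quadratic_le he _).trans h2)).1
    have h4 : ∑ a, ∑ b, e a * e b *
        (1 / (n : ℝ) * ∑ i ∈ Finset.range n, x i a * x i b - D a b) =
        1 / (n : ℝ) * ∑ i ∈ Finset.range n, inner ℝ e (x i) ^ 2 -
          ∑ a, ∑ b, e a * e b * D a b := by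
      have := sum_mul_inner_sq e (fun _ => 1) x n
      simp only [one_mul] at this
      rw [this, Finset.mul_sum, ← Finset.sum_sub_distrib]
      refine Finset.sum_congr rfl fun a _ => ?_
      rw [Finset.mul_sum, ← Finset.sum_sub_distrib]
      exact Finset.sum_congr rfl fun b _ => by ring
    rw [h4] at h3
    have h5 := hlow e he
    have h6 : lam / 2 ≤ 1 / (n : ℝ) * ∑ i ∈ Finset.range n, inner ℝ e (x i) ^ 2 := by linarith
    rw [one_div_mul_eq_div, le_div_iff₀ hn'] at h6
    linarith

end Design

/-! ### Deterministic comparison of drift and noise. -/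

section Deviation

variable {p : ℕ} {Ω : Type*} [MeasurableSpace Ω] {P : Measure Ω} [IsProbabilityMeasure P]

/-- The deterministic half of the deviation bound: a fit far from `β` forces the centred window
and score sums to be large. -/
theorem le_noise_of_lt_norm_sub {n : ℕ} {x : ℕ → Vec p} {y : ℕ → ℝ} {t : ℝ}
    {b β : Vec p} (hb : IsQuantileRegressionFit n x y t b) {ρ η c L : ℝ} (hρ : 0 < ρ)
    (hη : 0 ≤ η) (hη1 : η ≤ 1) {u v q : ℕ → ℝ} (hq : ∀ i, q i = c * η * ρ * ‖x i‖)
    (hu : ∀ i ∈ Finset.range n, u i ≤ inner ℝ β (x i) ∧ inner ℝ β (x i) - η * ρ * ‖x i‖ ≤ u i)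
    (hv : ∀ i ∈ Finset.range n, inner ℝ β (x i) ≤ v i ∧ v i ≤ inner ℝ β (x i) + η * ρ * ‖x i‖)
    (hc : 0 ≤ c)
    (hL : ∀ e : Vec p, ‖e‖ = 1 → L ≤ ∑ i ∈ Finset.range n, inner ℝ e (x i) ^ 2 -
      2 * η * ∑ i ∈ Finset.range n, ‖x i‖ ^ 2)
    (h : ρ < ‖b - β‖) :
    c * η * ρ * L ≤
      (∑ a, |∑ i ∈ Finset.range n, score t (u i) (v i) (y i) * x i a|) +
      (∑ a, ∑ a', |∑ i ∈ Finset.range n,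
        (window (u i) (v i) (y i) - 2 * q i) * (x i a * x i a' / (2 * ‖x i‖))|) +
      |∑ i ∈ Finset.range n, (window (u i) (v i) (y i) - 2 * q i) * ‖x i‖| := by
  obtain ⟨e, he, hle⟩ := hb.exists_direction β hρ.le h
  -- `le_pinball_sub` with `V = ρ‖x i‖` and `d = ηρ‖x i‖`, the window being split into its mean `2 *
  -- q i` and a centred part. The choice of `q i` cancels the denominator `‖x i‖` in the mean part.
  have hterm : ∀ i ∈ Finset.range n,
      ρ * (c * η * ρ * (inner ℝ e (x i) ^ 2 - 2 * η * ‖x i‖ ^ 2) +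
        (window (u i) (v i) (y i) - 2 * q i) * (1 / (2 * ‖x i‖)) * inner ℝ e (x i) ^ 2 -
        η * ((window (u i) (v i) (y i) - 2 * q i) * ‖x i‖) -
        score t (u i) (v i) (y i) * inner ℝ e (x i)) ≤
      pinball t (y i - inner ℝ β (x i) - ρ * inner ℝ e (x i)) -
        pinball t (y i - inner ℝ β (x i)) := by
    intro i hi
    have hcs : |inner ℝ e (x i)| ≤ ‖x i‖ := by
      simpa [he] using abs_real_inner_le_norm e (x i)
    refine le_trans (le_of_eq ?_) (le_pinball_sub (hu i hi).1 (hv i hi).1 (hu i hi).2 (hv i hi).2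
      (V := ρ * ‖x i‖) (by rw [abs_mul, abs_of_pos hρ]; exact mul_le_mul_of_nonneg_left hcs hρ.le))
    rw [hq]
    -- For a zero covariate the divisions are by zero, but the inner product vanishes too.
    rcases (norm_nonneg (x i)).eq_or_lt with h0 | h0
    · rw [← h0] at hcs ⊢
      simp [abs_nonpos_iff.1 hcs]
    · field_simp
      ring
  have hsum := (Finset.sum_le_sum hterm).trans hle
  rw [← Finset.mul_sum] at hsum
  have hsum' := nonpos_of_mul_nonpos_right hsum hρ
  rw [Finset.sum_sub_distrib, Finset.sum_sub_distrib, Finset.sum_add_distrib, ← Finset.mul_sum,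
    ← Finset.mul_sum, Finset.sum_sub_distrib, ← Finset.mul_sum] at hsum'
  have h1 := (abs_le.1 (abs_sum_mul_inner_le he (fun i => score t (u i) (v i) (y i)) x n)).2
  have h2 := (abs_le.1 (abs_quadratic_le he fun a a' => ∑ i ∈ Finset.range n,
    (window (u i) (v i) (y i) - 2 * q i) * (1 / (2 * ‖x i‖)) * (x i a * x i a'))).1
  rw [← sum_mul_inner_sq] at h2
  have h3 : η * ∑ i ∈ Finset.range n, (window (u i) (v i) (y i) - 2 * q i) * ‖x i‖ ≤
      |∑ i ∈ Finset.range n, (window (u i) (v i) (y i) - 2 * q i) * ‖x i‖| :=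
    (mul_le_mul_of_nonneg_left (le_abs_self _) hη).trans (mul_le_of_le_one_left (abs_nonneg _) hη1)
  have h4 := mul_le_mul_of_nonneg_left (hL e he) (show 0 ≤ c * η * ρ by positivity)
  have h5 : ∀ a a', ∑ i ∈ Finset.range n, (window (u i) (v i) (y i) - 2 * q i) *
      (1 / (2 * ‖x i‖)) * (x i a * x i a') = ∑ i ∈ Finset.range n,
        (window (u i) (v i) (y i) - 2 * q i) * (x i a * x i a' / (2 * ‖x i‖)) := fun a a' =>
    Finset.sum_congr rfl fun i _ => by ring
  simp only [h5] at h2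
  linarith

end Deviation

/-! ### Exact means of window and score. -/

section Means

theorem integrable_indicator_one {μ : Measure ℝ} [IsProbabilityMeasure μ] {s : Set ℝ}
    (hs : MeasurableSet s) : Integrable (fun y => s.indicator (1 : ℝ → ℝ) y) μ :=
  (integrable_const (1 : ℝ)).indicator hs

theorem integrable_window {μ : Measure ℝ} [IsProbabilityMeasure μ] (a b : ℝ) :
    Integrable (fun y => window a b y) μ :=
  integrable_indicator_one measurableSet_Ioc

variable {μ : Measure ℝ} [IsProbabilityMeasure μ] [NullSingletonClass μ]

theorem integral_window_quantile {t q : ℝ} (hq : 0 ≤ q) (h0 : 0 < t - q) (h1 : t + q < 1) :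
    ∫ y, window (quantile μ (t - q)) (quantile μ (t + q)) y ∂μ = 2 * q := by
  unfold window
  rw [integral_indicator_one measurableSet_Ioc, measureReal_Ioc_quantile ⟨h0, by linarith⟩
    ⟨by linarith, h1⟩ (by linarith)]
  ring

/-- Half the window contributes `q` and the lower tail `t - q`: a window symmetric in levels keeps
the score exactly centred. -/
theorem integral_score_quantile {t q : ℝ} (hq : 0 ≤ q) (h0 : 0 < t - q) (h1 : t + q < 1) :
    ∫ y, score t (quantile μ (t - q)) (quantile μ (t + q)) y ∂μ = 0 := by
  have hw : Integrable (fun y => window (quantile μ (t - q)) (quantile μ (t + q)) y / 2) μ :=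
    (integrable_window _ _).div_const 2
  have htw : Integrable
      (fun y => t - window (quantile μ (t - q)) (quantile μ (t + q)) y / 2) μ :=
    (integrable_const t).sub hw
  have hi := integrable_indicator_one (μ := μ) (measurableSet_Iic (a := quantile μ (t - q)))
  unfold score
  rw [integral_sub htw hi, integral_sub (integrable_const t) hw,
    integral_div, integral_window_quantile hq h0 h1, integral_indicator_one measurableSet_Iic,
    measureReal_Iic_quantile ⟨h0, by linarith⟩]
  simp

end Means

/-! ### Probabilistic deviation bounds for the fits. -/

section FitDeviation

variable {p : ℕ} {Ω : Type*} [MeasurableSpace Ω] {P : Measure Ω} [IsProbabilityMeasure P]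

/-- A finite-sample deviation bound for quantile regression fits. -/
theorem measure_lt_norm_fit_sub_le {n : ℕ} {x : ℕ → Vec p} {ν : ℕ → Measure ℝ}
    [∀ i, IsProbabilityMeasure (ν i)] [∀ i, NullSingletonClass (ν i)]
    {y : ℕ → Ω → ℝ} (hy : ∀ i, Measurable (y i)) (hlaw : ∀ i, P.map (y i) = ν i)
    (hindep : iIndepFun y P) {t : ℝ} (ht0 : 0 < t) (ht1 : t < 1) {β : Vec p}
    (hβ : ∀ i, quantile (ν i) t = inner ℝ β (x i))
    {b : Ω → Vec p} (hb : ∀ᵐ ω ∂P, IsQuantileRegressionFit n x (fun i => y i ω) t (b ω))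
    {ρ η c L : ℝ} (hρ : 0 < ρ) (hη : 0 < η) (hη1 : η ≤ 1) (hc : 0 < c) (hLpos : 0 < L)
    {q : ℕ → ℝ} (hq : ∀ i, q i = c * η * ρ * ‖x i‖)
    (hq0 : ∀ i ∈ Finset.range n, 0 < t - q i) (hq1 : ∀ i ∈ Finset.range n, t + q i < 1)
    (hqu : ∀ i ∈ Finset.range n, c * (quantile (ν i) t - quantile (ν i) (t - q i)) ≤ q i)
    (hqv : ∀ i ∈ Finset.range n, c * (quantile (ν i) (t + q i) - quantile (ν i) t) ≤ q i)
    (hL : ∀ e : Vec p, ‖e‖ = 1 → L ≤ ∑ i ∈ Finset.range n, inner ℝ e (x i) ^ 2 -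
      2 * η * ∑ i ∈ Finset.range n, ‖x i‖ ^ 2) :
    P {ω | ρ < ‖b ω - β‖} ≤ ENNReal.ofReal
      ((p + p * p + 1) * √(∑ i ∈ Finset.range n, ‖x i‖ ^ 2) / (c * η * ρ * L)) := by
  have hqnn : ∀ i, 0 ≤ q i := fun i => by rw [hq]; positivity
  set u : ℕ → ℝ := fun i => quantile (ν i) (t - q i) with hu
  set v : ℕ → ℝ := fun i => quantile (ν i) (t + q i) with hv
  set A := ∑ i ∈ Finset.range n, ‖x i‖ ^ 2 with hA
  have hu' : ∀ i ∈ Finset.range n,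
      u i ≤ inner ℝ β (x i) ∧ inner ℝ β (x i) - η * ρ * ‖x i‖ ≤ u i := by
    intro i hi
    rw [← hβ]
    refine ⟨quantile_monotoneOn ⟨hq0 i hi, by linarith [hqnn i]⟩ ⟨ht0, ht1⟩
      (by linarith [hqnn i]), ?_⟩
    have h := le_of_mul_le_mul_left
      ((hqu i hi).trans_eq (show q i = c * (η * ρ * ‖x i‖) by rw [hq]; ring)) hc
    linarith
  have hv' : ∀ i ∈ Finset.range n,
      inner ℝ β (x i) ≤ v i ∧ v i ≤ inner ℝ β (x i) + η * ρ * ‖x i‖ := by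
    intro i hi
    rw [← hβ]
    refine ⟨quantile_monotoneOn ⟨ht0, ht1⟩ ⟨by linarith [hqnn i], hq1 i hi⟩
      (by linarith [hqnn i]), ?_⟩
    have h := le_of_mul_le_mul_left
      ((hqv i hi).trans_eq (show q i = c * (η * ρ * ‖x i‖) by rw [hq]; ring)) hc
    linarith
  have hWm : ∀ i, Measurable fun z => window (u i) (v i) z - 2 * q i := fun i =>
    (measurable_window _ _).sub_const _
  have hZm : ∀ i, Measurable (score t (u i) (v i)) := fun i => measurable_score _ _ _
  have hWmean : ∀ i ∈ Finset.range n, ∫ ω, (window (u i) (v i) (y i ω) - 2 * q i) ∂P = 0 := by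
    intro i hi
    rw [← integral_map (f := fun z => window (u i) (v i) z - 2 * q i) (hy i).aemeasurable
      (hWm i).aestronglyMeasurable, hlaw i, integral_sub
        (integrable_window _ _) (integrable_const _),
      integral_window_quantile (hqnn i) (hq0 i hi) (hq1 i hi)]
    simp
  have hZmean : ∀ i ∈ Finset.range n, ∫ ω, score t (u i) (v i) (y i ω) ∂P = 0 := by
    intro i hi
    rw [← integral_map (f := score t (u i) (v i)) (hy i).aemeasurable
      (hZm i).aestronglyMeasurable, hlaw i,
      integral_score_quantile (hqnn i) (hq0 i hi) (hq1 i hi)]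
  have hWbd : ∀ i ∈ Finset.range n, ∀ z, |window (u i) (v i) z - 2 * q i| ≤ 1 := by
    intro i hi z
    have h0 := hq0 i hi; have h1 := hq1 i hi; have h2 := hqnn i
    rw [abs_le]
    rcases window_cases (u i) (v i) z with h | h <;> rw [h] <;> constructor <;> linarith
  -- All weights that occur are at most `‖x i‖`, so each of the `p + p * p + 1` noise sums has mean
  -- absolute value at most `√A`.
  have hwle : ∀ w : ℕ → ℝ, (∀ i, |w i| ≤ ‖x i‖) → √(∑ i ∈ Finset.range n, w i ^ 2) ≤ √A :=
    fun w hw => Real.sqrt_le_sqrt (Finset.sum_le_sum fun i _ => by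
      rw [← sq_abs]; exact pow_le_pow_left₀ (abs_nonneg _) (hw i) 2)
  have hW : ∀ w : ℕ → ℝ, (∀ i, |w i| ≤ ‖x i‖) →
      ∫ ω, |∑ i ∈ Finset.range n, (window (u i) (v i) (y i ω) - 2 * q i) * w i| ∂P ≤ √A :=
    fun w hw => (integral_abs_sum_le (fun i => (hWm i).comp (hy i)) (hindep.comp _ hWm)
      (fun i hi ω => hWbd i hi _) hWmean w).trans (hwle w hw)
  have hZ : ∀ w : ℕ → ℝ, (∀ i, |w i| ≤ ‖x i‖) →
      ∫ ω, |∑ i ∈ Finset.range n, score t (u i) (v i) (y i ω) * w i| ∂P ≤ √A :=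
    fun w hw => (integral_abs_sum_le (fun i => (hZm i).comp (hy i)) (hindep.comp _ hZm)
      (fun i hi ω => abs_score_le ht0.le ht1.le _ _ _) hZmean w).trans (hwle w hw)
  have hWi : ∀ w : ℕ → ℝ, Integrable
      (fun ω => |∑ i ∈ Finset.range n, (window (u i) (v i) (y i ω) - 2 * q i) * w i|) P :=
    fun w => (integrable_finsetSum _ fun i hi => (Integrable.of_bound
      ((hWm i).comp (hy i)).aestronglyMeasurable 1
      (ae_of_all _ fun ω => hWbd i hi _)).mul_const _).abs
  have hZi : ∀ w : ℕ → ℝ, Integrable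
      (fun ω => |∑ i ∈ Finset.range n, score t (u i) (v i) (y i ω) * w i|) P :=
    fun w => (integrable_finsetSum _ fun i hi => (Integrable.of_bound
      ((hZm i).comp (hy i)).aestronglyMeasurable 1
      (ae_of_all _ fun ω => abs_score_le ht0.le ht1.le _ _ _)).mul_const _).abs
  have hxa : ∀ a i, |x i a| ≤ ‖x i‖ := fun a i => abs_apply_le_norm _ _
  have hxaa : ∀ a a' i, |x i a * x i a' / (2 * ‖x i‖)| ≤ ‖x i‖ := by
    intro a a' i
    rw [abs_div, abs_mul, abs_of_nonneg (show 0 ≤ 2 * ‖x i‖ by positivity)]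
    refine div_le_of_le_mul₀ (by positivity) (norm_nonneg _) ?_
    have := mul_le_mul (hxa a i) (hxa a' i) (abs_nonneg _) (norm_nonneg _)
    nlinarith [norm_nonneg (x i)]
  set N : Ω → ℝ := fun ω =>
    (∑ a, |∑ i ∈ Finset.range n, score t (u i) (v i) (y i ω) * x i a|) +
      (∑ a, ∑ a', |∑ i ∈ Finset.range n,
        (window (u i) (v i) (y i ω) - 2 * q i) * (x i a * x i a' / (2 * ‖x i‖))|) +
      |∑ i ∈ Finset.range n, (window (u i) (v i) (y i ω) - 2 * q i) * ‖x i‖| with hN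
  have hi1 : Integrable (fun ω =>
      ∑ a, |∑ i ∈ Finset.range n, score t (u i) (v i) (y i ω) * x i a|) P :=
    integrable_finsetSum _ fun a _ => hZi _
  have hi2 : Integrable (fun ω => ∑ a, ∑ a', |∑ i ∈ Finset.range n,
        (window (u i) (v i) (y i ω) - 2 * q i) * (x i a * x i a' / (2 * ‖x i‖))|) P :=
    integrable_finsetSum _ fun a _ => integrable_finsetSum _ fun a' _ => hWi _
  have hi3 := hWi fun i => ‖x i‖
  have hi12 := hi1.add hi2
  have hNi : Integrable N P := hi12.add hi3
  have hNle : ∫ ω, N ω ∂P ≤ (p + p * p + 1) * √A := by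
    have e1 : ∫ ω, ∑ a, |∑ i ∈ Finset.range n, score t (u i) (v i) (y i ω) * x i a| ∂P ≤
        p * √A := by
      rw [integral_finsetSum _ fun a _ => hZi _]
      refine (Finset.sum_le_sum fun a _ => hZ _ (hxa a)).trans ?_
      simp
    have e2 : ∫ ω, ∑ a, ∑ a', |∑ i ∈ Finset.range n,
        (window (u i) (v i) (y i ω) - 2 * q i) * (x i a * x i a' / (2 * ‖x i‖))| ∂P ≤
        p * p * √A := by
      rw [integral_finsetSum _ fun a _ => integrable_finsetSum _ fun a' _ => hWi _]
      have : ∀ a : Fin p, ∫ ω, ∑ a', |∑ i ∈ Finset.range n,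
          (window (u i) (v i) (y i ω) - 2 * q i) * (x i a * x i a' / (2 * ‖x i‖))| ∂P ≤
          p * √A := by
        intro a
        rw [integral_finsetSum _ fun a' _ => hWi _]
        refine (Finset.sum_le_sum fun a' _ => hW _ (hxaa a a')).trans ?_
        simp
      refine (Finset.sum_le_sum fun a _ => this a).trans ?_
      simp [mul_assoc]
    have e3 := hW _ fun i => (abs_norm (x i)).le
    have e4 := (integral_add hi12 hi3).trans
      (congrArg (· + _) (integral_add hi1 hi2))
    refine e4.trans_le ?_
    linarith
  have hNnn : 0 ≤ᵐ[P] N := ae_of_all _ fun ω => by simp only [hN, Pi.zero_apply]; positivity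
  have hpos : 0 < c * η * ρ * L := by positivity
  -- `b` need not be measurable: Markov's inequality is applied only to `N`.
  have hsub : P {ω | ρ < ‖b ω - β‖} ≤ P {ω | c * η * ρ * L ≤ N ω} := by
    refine measure_mono_ae ?_
    filter_upwards [hb] with ω hω h
    exact le_noise_of_lt_norm_sub hω hρ hη.le hη1 hq hu' hv' hc.le hL h
  have hmarkov := mul_meas_ge_le_integral_of_nonneg hNnn hNi (c * η * ρ * L)
  refine hsub.trans ?_
  rw [← ofReal_measureReal]
  refine ENNReal.ofReal_le_ofReal ?_
  rw [le_div_iff₀ hpos, mul_comm]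
  exact hmarkov.trans hNle

/-- Quantile regression fits are `√n`-consistent, uniformly over compact ranges of levels. -/
theorem exists_measure_fit_deviation_le {X : Set (Vec p)}
    {law : Vec p → Measure ℝ} {f : Vec p → ℝ → ℝ}
    (hprob : ∀ x ∈ X, IsProbabilityMeasure (law x))
    {xs : ℕ → Vec p} (hxs : ∀ i, xs i ∈ X)
    {β : ℝ → Vec p} (hβ : ContinuousOn β (Set.Ioo 0 1))
    (hQ : ∀ x ∈ X, ∀ τ ∈ Set.Ioo (0 : ℝ) 1, quantile (law x) τ = inner ℝ (β τ) x)
    (h2 : RegularDensities X law f) (h3 : RegularDesign law f xs)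
    {y : ℕ → Ω → ℝ} (hy : ∀ i, Measurable (y i))
    (hlaw : ∀ i, P.map (y i) = law (xs i)) (hindep : iIndepFun y P)
    {τl τu : ℝ} (hl : 0 < τl) (hlu : τl < τu) (hu : τu < 1) {ε : ℝ} (hε : 0 < ε) :
    ∃ K : ℝ, ∀ᶠ n : ℕ in atTop, ∀ t ∈ Set.Icc τl τu, ∀ b : Ω → Vec p,
      (∀ᵐ ω ∂P, IsQuantileRegressionFit n xs (fun i => y i ω) t (b ω)) →
      P {ω | K / √(n : ℝ) < ‖b ω - β t‖} ≤ ENNReal.ofReal ε := by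
  have hprob' : ∀ i, IsProbabilityMeasure (law (xs i)) := fun i => hprob _ (hxs i)
  have hatom : ∀ i, NullSingletonClass (law (xs i)) := fun i => by
    rw [(h2.1 _ (hxs i)).2.2]; infer_instance
  obtain ⟨D₀, -, hD₀, -, hlim, -⟩ := h3.1 τl τu hl hlu hu
  obtain ⟨lam, T, hlam, hlamT, hgram⟩ := eventually_gram_bounds hD₀ hlim
  have hT : 0 < T := hlam.trans_le hlamT
  -- A wider range of levels leaves room for the windows `t ± q i`.
  set l' := τl / 2 with hl'
  set u' := (1 + τu) / 2 with hu'
  obtain ⟨hc0, hc1, -⟩ := h2.2.2 l' u' (by positivity) (by linarith) (by linarith)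
  set c₀ := ⨅ τ ∈ Set.Icc l' u', ⨅ x ∈ X, ENNReal.ofReal (f x (quantile (law x) τ)) with hc₀
  set c := c₀.toReal with hcdef
  have hc : 0 < c := ENNReal.toReal_pos hc0.ne' hc1.ne
  have hcf : ∀ i, ∀ τ ∈ Set.Icc l' u', c ≤ f (xs i) (quantile (law (xs i)) τ) := by
    intro i τ hτ
    have h : c₀ ≤ ENNReal.ofReal (f (xs i) (quantile (law (xs i)) τ)) :=
      (iInf₂_le τ hτ).trans (iInf₂_le (xs i) (hxs i))
    exact ENNReal.toReal_le_of_le_ofReal ((h2.1 _ (hxs i)).2.1 _) h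
  -- With this `η` the window-width penalty `2η·nT` costs exactly half of the drift `n * lam`.
  set η := lam / (4 * T) with hη
  have hη0 : 0 < η := by positivity
  have hη1 : η ≤ 1 := by rw [hη, div_le_one (by positivity)]; linarith
  set J : ℝ := p + p * p + 1 with hJ
  have hJ0 : 0 < J := by positivity
  -- Chosen so that the deviation bound at `ρ = K / √n`, `L = n * lam / 2` is at most `ε`.
  set K : ℝ := 2 * J * √T / (c * η * lam * ε) with hK
  have hK0 : 0 < K := by positivity
  set d := min (τl / 2) ((1 - τu) / 2) with hd
  have hd0 : 0 < d := lt_min (by linarith) (by linarith)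
  refine ⟨K, ?_⟩
  filter_upwards [hgram, h3.2.def (show 0 < d / (c * η * K) by positivity),
    eventually_gt_atTop 0] with n hn hmax hnpos t ht b hb
  have hn0 : (0 : ℝ) < n := Nat.cast_pos.2 hnpos
  have hsn : 0 < √(n : ℝ) := Real.sqrt_pos.2 hn0
  -- Here `max ‖x i‖ = o(√n)` enters: it keeps all windows inside `[l', u']`.
  have hqd : ∀ i ∈ Finset.range n, c * η * (K / √(n : ℝ)) * ‖xs i‖ ≤ d := by
    intro i hi
    have h1 : ‖xs i‖ ≤ ⨆ j : Fin n, ‖xs j‖ :=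
      le_ciSup (f := fun j : Fin n => ‖xs j‖) (Set.finite_range _).bddAbove
        ⟨i, Finset.mem_range.1 hi⟩
    have h2 : ‖xs i‖ ≤ d / (c * η * K) * √(n : ℝ) := by
      refine (h1.trans (le_abs_self _)).trans ?_
      rw [Real.norm_eq_abs, Real.norm_eq_abs, abs_of_pos hsn] at hmax
      exact hmax
    calc c * η * (K / √(n : ℝ)) * ‖xs i‖
        ≤ c * η * (K / √(n : ℝ)) * (d / (c * η * K) * √(n : ℝ)) := by gcongr
      _ = d := by field_simp
  have hdl : d ≤ τl / 2 := min_le_left _ _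
  have hdu : d ≤ (1 - τu) / 2 := min_le_right _ _
  have ht0 : t ∈ Set.Ioo (0 : ℝ) 1 := ⟨hl.trans_le ht.1, ht.2.trans_lt hu⟩
  have hcont : ∀ i, ContinuousOn (quantile (law (xs i))) (Set.Ioo 0 1) := fun i =>
    ContinuousOn.congr (f := fun τ => inner ℝ (β τ) (xs i))
      (hβ.inner continuousOn_const) (fun τ hτ => hQ _ (hxs i) τ hτ)
  have hslope : ∀ i, ∀ s ∈ Set.Icc l' u', ∀ s' ∈ Set.Icc l' u', s ≤ s' →
      c * (quantile (law (xs i)) s' - quantile (law (xs i)) s) ≤ s' - s := by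
    intro i s hs s' hs' hss
    have hIcc : Set.Icc s s' ⊆ Set.Icc l' u' := Set.Icc_subset_Icc hs.1 hs'.2
    have hIoo : Set.Icc l' u' ⊆ Set.Ioo (0 : ℝ) 1 := fun z hz =>
      ⟨by linarith [hz.1], by linarith [hz.2]⟩
    exact mul_quantile_sub_le (h2.1 _ (hxs i)).1 (h2.1 _ (hxs i)).2.2 hc.le (hIoo hs)
      (hIoo hs') hss ((hcont i).mono (hIcc.trans hIoo)) fun τ hτ => hcf i τ (hIcc hτ)
  have hqnn : ∀ i, 0 ≤ c * η * (K / √(n : ℝ)) * ‖xs i‖ := fun i => by positivity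
  have ht1 := ht.1
  have ht2 := ht.2
  have htm : t ∈ Set.Icc l' u' := ⟨by linarith, by linarith⟩
  refine (measure_lt_norm_fit_sub_le (ν := fun i => law (xs i)) hy hlaw hindep ht0.1 ht0.2
    (fun i => hQ _ (hxs i) t ht0) hb (ρ := K / √(n : ℝ)) (η := η) (c := c) (L := n * lam / 2)
    (by positivity) hη0 hη1 hc (by positivity)
    (q := fun i => c * η * (K / √(n : ℝ)) * ‖xs i‖) (fun i => rfl)
    (fun i hi => by linarith [hqd i hi]) (fun i hi => by linarith [hqd i hi])
    (fun i hi => ?_) (fun i hi => ?_) (fun e he => ?_)).trans (ENNReal.ofReal_le_ofReal ?_)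
  · have := hslope i _ ⟨by linarith [hqd i hi], by linarith [hqnn i]⟩ t htm
      (sub_le_self t (hqnn i))
    simpa using this
  · have := hslope i t htm _ ⟨by linarith [hqnn i], by linarith [hqd i hi]⟩
      (le_add_of_nonneg_right (hqnn i))
    simpa using this
  · have h1 := hn.2 e he
    have h2 : 2 * η * ∑ i ∈ Finset.range n, ‖xs i‖ ^ 2 ≤ 2 * η * (n * T) :=
      mul_le_mul_of_nonneg_left hn.1 (by positivity)
    have h3 : 2 * η * (n * T) = n * lam / 2 := by rw [hη]; field_simp; ring
    linarith
  · have h1 : √(∑ i ∈ Finset.range n, ‖xs i‖ ^ 2) ≤ √(n : ℝ) * √T := by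
      rw [← Real.sqrt_mul hn0.le]; exact Real.sqrt_le_sqrt hn.1
    have h2 : c * η * (K / √(n : ℝ)) * (n * lam / 2) = J * √T * √(n : ℝ) / ε := by
      have : (n : ℝ) = √(n : ℝ) * √(n : ℝ) := (Real.mul_self_sqrt hn0.le).symm
      rw [hK]
      nth_rewrite 2 [this]
      field_simp
    rw [h2, div_le_iff₀ (by positivity)]
    have h3 : ε * (J * √T * √(n : ℝ) / ε) = J * (√(n : ℝ) * √T) := by field_simp
    rw [h3]
    exact mul_le_mul_of_nonneg_left h1 hJ0.le

end FitDeviation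

/-! ### Interpolation between grid levels. -/

section Interpolation

theorem mul_sub_floor_div_mem {m : ℕ} {u : ℝ} (hu : 0 ≤ u) :
    (m : ℝ) * (u - (⌊(m : ℝ) * u⌋₊ : ℝ) / m) ∈ Set.Icc (0 : ℝ) 1 := by
  rcases m.eq_zero_or_pos with rfl | hm
  · simp
  · have hm' : (m : ℝ) ≠ 0 := Nat.cast_ne_zero.2 hm.ne'
    rw [mul_sub, mul_div_cancel₀ _ hm']
    have h1 := Nat.floor_le (show 0 ≤ (m : ℝ) * u by positivity)
    have h2 := Nat.lt_floor_add_one ((m : ℝ) * u)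
    constructor <;> linarith

theorem abs_add_mul_sub_le {a b c θ : ℝ} (hθ : θ ∈ Set.Icc (0 : ℝ) 1) :
    |a + θ * (b - a) - c| ≤ max |a - c| |b - c| := by
  have h0 : 0 ≤ 1 - θ := sub_nonneg.2 hθ.2
  calc |a + θ * (b - a) - c| = |(1 - θ) * (a - c) + θ * (b - c)| := by ring_nf
    _ ≤ (1 - θ) * |a - c| + θ * |b - c| := by
      refine (abs_add_le _ _).trans_eq ?_
      rw [abs_mul, abs_mul, abs_of_nonneg h0, abs_of_nonneg hθ.1]
    _ ≤ (1 - θ) * max |a - c| |b - c| + θ * max |a - c| |b - c| :=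
      add_le_add (mul_le_mul_of_nonneg_left (le_max_left _ _) h0)
        (mul_le_mul_of_nonneg_left (le_max_right _ _) hθ.1)
    _ = max |a - c| |b - c| := by ring

/-- The range `m + 2` covers the index `⌊m u⌋ + 1 ≤ m + 1`, and the index `1` even when `m = 0`. -/
theorem abs_interpolate_le (m : ℕ) (q : ℕ → ℝ) {u : ℝ} (hu : u ∈ Set.Ioo (0 : ℝ) 1) :
    |interpolate m q u| ≤ ∑ j ∈ Finset.range (m + 2), |q j| := by
  have hq : ∀ j < m + 2, |q j| ≤ ∑ j ∈ Finset.range (m + 2), |q j| := fun j hj =>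
    Finset.single_le_sum (f := fun j => |q j|) (fun i _ => abs_nonneg _) (Finset.mem_range.2 hj)
  have hk : ⌊(m : ℝ) * u⌋₊ ≤ m :=
    Nat.floor_le_of_le (mul_le_of_le_one_right (Nat.cast_nonneg m) hu.2.le)
  unfold interpolate
  split_ifs
  · exact hq _ (by omega)
  · exact hq _ (by omega)
  · have := abs_add_mul_sub_le (a := q ⌊(m : ℝ) * u⌋₊) (b := q (⌊(m : ℝ) * u⌋₊ + 1)) (c := 0)
      (mul_sub_floor_div_mem (m := m) hu.1.le)
    simp only [sub_zero] at this
    exact this.trans (max_le (hq _ (by omega)) (hq _ (by omega)))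

theorem measurable_interpolate {α : Type*} [MeasurableSpace α] (m : ℕ) {q : ℕ → α → ℝ}
    (hq : ∀ j, Measurable (q j)) :
    Measurable fun z : α × ℝ => interpolate m (fun j => q j z.1) z.2 := by
  have hfl : Measurable fun z : α × ℝ => ⌊(m : ℝ) * z.2⌋₊ :=
    Nat.measurable_floor.comp (measurable_snd.const_mul _)
  -- Evaluation at a random index is measurable because the indices are countable.
  have hjoint : Measurable fun w : α × ℕ => q w.2 w.1 :=
    measurable_from_prod_countable_left fun j => hq j
  have h0 : Measurable fun z : α × ℝ => q ⌊(m : ℝ) * z.2⌋₊ z.1 :=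
    hjoint.comp (measurable_fst.prodMk hfl)
  have h1 : Measurable fun z : α × ℝ => q (⌊(m : ℝ) * z.2⌋₊ + 1) z.1 :=
    hjoint.comp (measurable_fst.prodMk (hfl.add_const 1))
  have hfl' : Measurable fun z : α × ℝ => (⌊(m : ℝ) * z.2⌋₊ : ℝ) :=
    measurable_from_top.comp hfl
  unfold interpolate
  refine Measurable.ite (measurableSet_lt measurable_snd measurable_const)
    ((hq 1).comp measurable_fst) (Measurable.ite (measurableSet_le measurable_const measurable_snd)
    ((hq _).comp measurable_fst) (h0.add (Measurable.mul ?_ (h1.sub h0))))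
  exact (measurable_snd.sub (hfl'.div_const _)).const_mul _

variable {p : ℕ}

theorem measurable_generate {α : Type*} [MeasurableSpace α] (m : ℕ) {b : ℕ → α → Vec p}
    (hb : ∀ j, Measurable (b j)) (x : Vec p) :
    Measurable fun z : α × ℝ => generate m (fun j => b j z.1) x z.2 :=
  measurable_interpolate m (q := fun j a => inner ℝ (b j a) x) fun j => (hb j).inner_const

theorem measurable_generate_right (m : ℕ) (b : ℕ → Vec p) (x : Vec p) :
    Measurable (generate m b x) :=
  (measurable_generate (α := Unit) m (b := fun j _ => b j) (fun _ => measurable_const) x).comp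
    (measurable_const (a := ()) |>.prodMk measurable_id)

theorem tendsto_floor_mul_div {m : ℕ → ℕ} (hm : Tendsto (fun n => (m n : ℝ)) atTop atTop)
    {u : ℝ} (hu : 0 ≤ u) :
    Tendsto (fun n => (⌊(m n : ℝ) * u⌋₊ : ℝ) / m n) atTop (𝓝 u) := by
  refine ((tendsto_nat_floor_mul_div_atTop hu).comp hm).congr fun n => ?_
  simp [mul_comm]

/-- Far inside the grid, the interpolation lies between the values at the two neighbouring
grid points. -/
theorem eventually_abs_interpolate_sub_le {m : ℕ → ℕ}
    (hm : Tendsto (fun n => (m n : ℝ)) atTop atTop) {u : ℝ} (hu : u ∈ Set.Ioo (0 : ℝ) 1) :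
    ∀ᶠ n in atTop, ∀ (q : ℕ → ℝ) (c : ℝ), |interpolate (m n) q u - c| ≤
      max |q ⌊(m n : ℝ) * u⌋₊ - c| |q (⌊(m n : ℝ) * u⌋₊ + 1) - c| := by
  have hinv : Tendsto (fun n => 1 / (m n : ℝ)) atTop (𝓝 0) := by
    simpa [Function.comp_def] using tendsto_inv_atTop_zero.comp hm
  filter_upwards [hinv.eventually_lt_const hu.1,
    hinv.eventually_lt_const (sub_pos.2 hu.2), hm.eventually_gt_atTop 0] with n h1 h2 h3 q c
  have h4 : ¬ ((m n : ℝ) - 1) / m n ≤ u := by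
    rw [sub_div, div_self h3.ne']; linarith
  rw [interpolate, if_neg (not_lt.2 h1.le), if_neg h4]
  exact abs_add_mul_sub_le (mul_sub_floor_div_mem hu.1.le)

end Interpolation

/-! ### Loss bounds and the coupling inequality. -/

section Loss

theorem measurable_loss (r l : ℝ) : Measurable (loss r l) :=
  (measurable_const.sub (measurable_id.const_mul r)).max measurable_const

theorem abs_loss_le (r l y : ℝ) : |loss r l y| ≤ |l| + |r| * |y| := by
  rw [loss, abs_of_nonneg (le_max_right _ _)]
  refine max_le ?_ (by positivity)
  rw [← abs_mul]
  linarith [le_abs_self l, neg_abs_le (r * y)]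

theorem abs_loss_le_of_nonneg {r l y : ℝ} (hr : 0 ≤ r) (hl : 0 ≤ l) (hy : 0 ≤ y) :
    |loss r l y| ≤ l := by
  rw [loss, abs_of_nonneg (le_max_right _ _)]
  exact max_le (by linarith [mul_nonneg hr hy]) hl

/-- The bound does not involve `l`, whence the uniformity; being bounded, it requires no moments of
the outputs. -/
theorem abs_loss_sub_le {r l lbar a b : ℝ} (hr : 0 ≤ r) (hl : l ∈ Set.Icc 0 lbar) (ha : 0 ≤ a)
    (hb : 0 ≤ b) : |loss r l a - loss r l b| ≤ min lbar (r * |a - b|) := by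
  refine le_min ?_ ?_
  · have h1 := (abs_of_nonneg (le_max_right (l - r * a) 0)).symm.trans_le
      (abs_loss_le_of_nonneg hr hl.1 ha)
    have h2 := (abs_of_nonneg (le_max_right (l - r * b) 0)).symm.trans_le
      (abs_loss_le_of_nonneg hr hl.1 hb)
    have h3 : 0 ≤ loss r l a := le_max_right _ _
    have h4 : 0 ≤ loss r l b := le_max_right _ _
    have h5 := hl.2
    change loss r l a ≤ l at h1
    change loss r l b ≤ l at h2
    rw [abs_le]
    constructor <;> linarith
  · refine (abs_max_sub_max_le_abs _ _ _).trans_eq ?_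
    rw [show l - r * a - (l - r * b) = -(r * (a - b)) by ring, abs_neg, abs_mul, abs_of_nonneg hr]

variable {α : Type*} [MeasurableSpace α] {μ : Measure α} [IsProbabilityMeasure μ]

theorem integrable_loss {Y : α → ℝ} (hY : AEMeasurable Y μ) (hnn : ∀ᵐ a ∂μ, 0 ≤ Y a)
    {r l : ℝ} (hr : 0 ≤ r) (hl : 0 ≤ l) : Integrable (fun a => loss r l (Y a)) μ :=
  Integrable.of_bound ((measurable_loss r l).comp_aemeasurable hY).aestronglyMeasurable l
    (hnn.mono fun _ ha => abs_loss_le_of_nonneg hr hl ha)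

theorem integrable_min {W : α → ℝ} (hW : AEMeasurable W μ) {r c : ℝ} (hr : 0 ≤ r) (hc : 0 ≤ c) :
    Integrable (fun a => min c (r * |W a|)) μ :=
  Integrable.of_bound (aemeasurable_const.min
      ((continuous_abs.measurable.comp_aemeasurable hW).const_mul r)).aestronglyMeasurable c
    (ae_of_all _ fun a => by
      rw [Real.norm_eq_abs, abs_of_nonneg (le_min hc (by positivity))]
      exact min_le_left _ _)

/-- Coupling bound for the difference of expected losses. -/
theorem abs_expectedLoss_sub_le {ν : Measure ℝ} {Y Z : α → ℝ} (hY : AEMeasurable Y μ)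
    (hZ : AEMeasurable Z μ) (hmap : μ.map Z = ν) (hν : ∀ᵐ y ∂ν, 0 ≤ y)
    (hnn : ∀ᵐ a ∂μ, 0 ≤ Y a) {r l lbar : ℝ} (hr : 0 ≤ r) (hl : l ∈ Set.Icc 0 lbar) :
    |expectedLoss μ Y r l - expectedLoss ν id r l| ≤ ∫ a, min lbar (r * |Y a - Z a|) ∂μ := by
  have hZnn : ∀ᵐ a ∂μ, 0 ≤ Z a := ae_of_ae_map hZ (hmap ▸ hν)
  have h : expectedLoss ν id r l = ∫ a, loss r l (Z a) ∂μ := by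
    rw [expectedLoss, ← hmap]
    exact integral_map hZ (measurable_loss r l).aestronglyMeasurable
  rw [h, expectedLoss, ← integral_sub (integrable_loss hY hnn hr hl.1)
    (integrable_loss hZ hZnn hr hl.1)]
  refine abs_integral_le_integral_abs.trans (integral_mono_ae
    ((integrable_loss hY hnn hr hl.1).sub (integrable_loss hZ hZnn hr hl.1)).abs
    (integrable_min (hY.sub hZ) hr (hl.1.trans hl.2)) ?_)
  filter_upwards [hnn, hZnn] with a h1 h2
  exact abs_loss_sub_le hr hl h1 h2

/-- Convergence in measure to zero implies convergence of bounded means. -/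
theorem tendsto_integral_min {W : ℕ → α → ℝ} (hW : ∀ n, AEMeasurable (W n) μ)
    (hlim : ∀ δ : ℝ, 0 < δ → Tendsto (fun n => μ {a | δ ≤ |W n a|}) atTop (𝓝 0))
    {r c : ℝ} (hr : 0 < r) (hc : 0 ≤ c) :
    Tendsto (fun n => ∫ a, min c (r * |W n a|) ∂μ) atTop (𝓝 0) := by
  have hnn : ∀ n, 0 ≤ ∫ a, min c (r * |W n a|) ∂μ := fun n =>
    integral_nonneg fun a => le_min hc (by positivity)
  rw [Metric.tendsto_atTop']
  intro ε hε
  -- Below this threshold the integrand is at most `ε / 2`; above it, at most `c`.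
  have hδ : 0 < ε / (2 * r) := by positivity
  have hreal : Tendsto (fun n => c * μ.real {a | ε / (2 * r) ≤ |W n a|}) atTop (𝓝 0) := by
    simpa [Function.comp_def, Measure.real] using ((ENNReal.tendsto_toReal ENNReal.zero_ne_top).comp (hlim _ hδ)).const_mul c
  obtain ⟨N, hN⟩ := (hreal.eventually_lt_const (half_pos hε)).exists_forall_of_atTop
  refine ⟨N, fun n hn => ?_⟩
  rw [Real.dist_eq, sub_zero, abs_of_nonneg (hnn n)]
  have hms : NullMeasurableSet {a | ε / (2 * r) ≤ |W n a|} μ :=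
    nullMeasurableSet_le aemeasurable_const
      (continuous_abs.measurable.comp_aemeasurable (hW n))
  have hle : ∫ a, min c (r * |W n a|) ∂μ ≤
      ∫ a, (ε / 2 + {a | ε / (2 * r) ≤ |W n a|}.indicator (fun _ => c) a) ∂μ := by
    refine integral_mono (integrable_min (hW n) hr.le hc)
      ((integrable_const _).add ((integrable_const c).indicator₀ hms)) fun a => ?_
    by_cases ha : ε / (2 * r) ≤ |W n a|
    · simp only [Set.mem_ofPred_eq, ha, Set.indicator_of_mem]
      linarith [min_le_left c (r * |W n a|)]
    · simp only [Set.mem_ofPred_eq, ha, not_false_eq_true, Set.indicator_of_notMem]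
      rw [add_zero]
      refine (min_le_right _ _).trans ?_
      calc r * |W n a| ≤ r * (ε / (2 * r)) := mul_le_mul_of_nonneg_left (not_le.1 ha).le hr.le
        _ = ε / 2 := by field_simp
  refine hle.trans_lt ?_
  rw [integral_add (integrable_const _) ((integrable_const c).indicator₀ hms),
    integral_indicator₀ hms]
  simp only [integral_const, probReal_univ, smul_eq_mul, one_mul, measureReal_restrict_apply_univ]
  have := hN n hn.le
  linarith

end Loss

/-! ### Consistency at a fixed level. -/

section Consistency

variable {p : ℕ} {Ω : Type*} [MeasurableSpace Ω] {P : Measure Ω} [IsProbabilityMeasure P]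

/-- Positivity is required because `1 / 0 = 0`. -/
theorem tendsto_cast_atTop_of_one_div {m : ℕ → ℕ}
    (hm : Tendsto (fun n => 1 / (m n : ℝ)) atTop (𝓝 0))
    (hpos : ∀ᶠ n in atTop, 0 < m n) : Tendsto (fun n => (m n : ℝ)) atTop atTop := by
  have h : Tendsto (fun n => 1 / (m n : ℝ)) atTop (𝓝[>] 0) :=
    tendsto_nhdsWithin_iff.2 ⟨hm, hpos.mono fun n hn =>
      Set.mem_Ioi.2 (one_div_pos.2 (Nat.cast_pos.2 hn))⟩
  refine (tendsto_inv_nhdsGT_zero.comp h).congr fun n => ?_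
  simp

/-- Fits at levels converging to `u` yield consistent estimates of the quantile of level `u`. -/
theorem tendsto_measure_le_abs_inner_fit_sub {X : Set (Vec p)}
    {law : Vec p → Measure ℝ} {f : Vec p → ℝ → ℝ}
    (hprob : ∀ x ∈ X, IsProbabilityMeasure (law x))
    {xs : ℕ → Vec p} (hxs : ∀ i, xs i ∈ X)
    {β : ℝ → Vec p} (hβ : ContinuousOn β (Set.Ioo 0 1))
    (hQ : ∀ x ∈ X, ∀ τ ∈ Set.Ioo (0 : ℝ) 1, quantile (law x) τ = inner ℝ (β τ) x)
    (h2 : RegularDensities X law f) (h3 : RegularDesign law f xs)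
    {y : ℕ → Ω → ℝ} (hy : ∀ i, Measurable (y i))
    (hlaw : ∀ i, P.map (y i) = law (xs i)) (hindep : iIndepFun y P)
    {u : ℝ} (hu : u ∈ Set.Ioo (0 : ℝ) 1) {t : ℕ → ℝ} (ht : Tendsto t atTop (𝓝 u))
    {b : ℕ → Ω → Vec p} (hb : ∀ᶠ n in atTop, ∀ᵐ ω ∂P,
      IsQuantileRegressionFit n xs (fun i => y i ω) (t n) (b n ω))
    (x : Vec p) {δ : ℝ} (hδ : 0 < δ) :
    Tendsto (fun n => P {ω | δ ≤ |inner ℝ (b n ω) x - inner ℝ (β u) x|}) atTop (𝓝 0) := by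
  rw [ENNReal.tendsto_nhds_zero]
  intro ε hε
  obtain ⟨ε', hε'0, hε'⟩ := ENNReal.lt_iff_exists_real_btwn.1 hε
  have hε'pos : 0 < ε' := ENNReal.ofReal_pos.1 hε'.1
  have hu0 := hu.1
  have hu1 := hu.2
  -- A compact neighbourhood of `u` inside `(0, 1)`; uniformity over it allows the level to move
  -- with `n`.
  obtain ⟨K, hK⟩ := exists_measure_fit_deviation_le (P := P) hprob hxs hβ hQ h2 h3 hy hlaw hindep
    (τl := u / 2) (τu := (1 + u) / 2) (by linarith) (by linarith) (by linarith) hε'pos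
  have hβu : Tendsto (fun n => β (t n)) atTop (𝓝 (β u)) :=
    ((hβ.continuousAt (Ioo_mem_nhds hu0 hu1)).tendsto).comp ht
  have hsmall : Tendsto (fun n : ℕ => (K / √(n : ℝ) + ‖β (t n) - β u‖) * ‖x‖) atTop (𝓝 0) := by
    have h1 : Tendsto (fun n : ℕ => K / √(n : ℝ)) atTop (𝓝 0) :=
      (Real.tendsto_sqrt_atTop.comp tendsto_natCast_atTop_atTop).const_div_atTop K
    have h2 := (tendsto_iff_norm_sub_tendsto_zero.1 hβu)
    simpa using (h1.add h2).mul_const ‖x‖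
  filter_upwards [hK, hb, hsmall.eventually_lt_const hδ,
    ht.eventually (Icc_mem_nhds (show u / 2 < u by linarith) (show u < (1 + u) / 2 by linarith))]
    with n h1 h2 h3 h4
  refine ((measure_mono fun ω hω => ?_).trans (h1 (t n) h4 (b n) h2)).trans hε'.2.le
  simp only [Set.mem_ofPred_eq] at hω ⊢
  by_contra! hle
  rw [← inner_sub_left] at hω
  have h5 := hω.trans (abs_real_inner_le_norm _ _)
  have h6 : ‖b n ω - β u‖ ≤ K / √(n : ℝ) + ‖β (t n) - β u‖ :=
    (norm_sub_le_norm_sub_add_norm_sub _ (β (t n)) _).trans (by gcongr)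
  have h7 := mul_le_mul_of_nonneg_right h6 (norm_nonneg x)
  linarith

end Consistency

end QRGMM

end

/-! ### The coupling argument. -/

theorem theorem2 {p : ℕ} (X : Set (QRGMM.Vec p))
    -- the law of the sales volume at each covariate vector, and its density
    (law : QRGMM.Vec p → Measure ℝ) (f : QRGMM.Vec p → ℝ → ℝ)
    (hprob : ∀ x ∈ X, IsProbabilityMeasure (law x))
    (hnonneg : ∀ x ∈ X, ∀ᵐ y ∂(law x), 0 ≤ y)
    -- the covariates of the data set
    (xs : ℕ → QRGMM.Vec p) (hxs : ∀ i, xs i ∈ X)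
    (h1 : QRGMM.LinearQuantiles X law)
    (h2 : QRGMM.RegularDensities X law f)
    (h3 : QRGMM.RegularDesign law f xs)
    -- the observed sales volumes: independent, the `i`-th one with the law at `xs i`
    {Ω : Type*} [MeasurableSpace Ω] (P : Measure Ω) [IsProbabilityMeasure P]
    (y : ℕ → Ω → ℝ) (hy : ∀ i, Measurable (y i))
    (hlaw : ∀ i, P.map (y i) = law (xs i))
    (hindep : iIndepFun y P)
    -- the number of grid cells as a function of the sample size
    (m : ℕ → ℕ) (hm : Tendsto (fun n => 1 / (m n : ℝ)) atTop (𝓝 0))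
    (hnm : Tendsto (fun n : ℕ => (n : ℝ) / (m n : ℝ)) atTop atTop)
    -- `bhat n j` is the quantile regression estimator of level `j / m n` from `n` observations
    (bhat : ℕ → ℕ → Ω → QRGMM.Vec p) (hbhat : ∀ n j, Measurable (bhat n j))
    (hfit : ∀ n, ∀ j ∈ Finset.Ico 1 (m n), ∀ᵐ ω ∂P,
      QRGMM.IsQuantileRegressionFit n xs (fun i => y i ω) ((j : ℝ) / (m n : ℝ)) (bhat n j ω))
    -- the new covariate vector, the unit revenue, and the maximal loan
    (x : QRGMM.Vec p) (hx : x ∈ X) (r : ℝ) (hr : 0 < r) (lbar : ℝ) (hlbar : 0 ≤ lbar)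
    -- generated sales volumes are nonnegative (for all large `n`, almost surely)
    (hgen : ∀ᶠ n in atTop, ∀ᵐ z ∂(P.prod QRGMM.uniform01),
      0 ≤ QRGMM.generate (m n) (fun j => bhat n j z.1) x z.2) :
    -- the expected losses exist
    (∀ l ∈ Set.Icc 0 lbar, Integrable (QRGMM.loss r l) (law x)) ∧
    (∀ᶠ n in atTop, ∀ l ∈ Set.Icc 0 lbar,
      Integrable (fun z : Ω × ℝ =>
        QRGMM.loss r l (QRGMM.generate (m n) (fun j => bhat n j z.1) x z.2))
        (P.prod QRGMM.uniform01)) ∧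
    (∀ n l ω, Integrable
        (fun u => QRGMM.loss r l (QRGMM.generate (m n) (fun j => bhat n j ω) x u))
        QRGMM.uniform01) ∧
    -- uniform convergence, the expectation being over the data and the uniform input
    TendstoUniformlyOn
      (fun n l => QRGMM.expectedLoss (P.prod QRGMM.uniform01)
        (fun z => QRGMM.generate (m n) (fun j => bhat n j z.1) x z.2) r l)
      (fun l => QRGMM.expectedLoss (law x) id r l)
      atTop (Set.Icc 0 lbar) ∧
    -- uniform convergence in probability, the expectation being over the uniform input for
    -- the given data
    (∀ ε : ℝ, 0 < ε → Tendsto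
      (fun n => P {ω | ∃ l ∈ Set.Icc 0 lbar,
        ε ≤ |QRGMM.expectedLoss QRGMM.uniform01
              (QRGMM.generate (m n) (fun j => bhat n j ω) x) r l
            - QRGMM.expectedLoss (law x) id r l|})
      atTop (𝓝 0)) := by
  obtain ⟨β, hβ, hQ⟩ := h1
  have hprobx : IsProbabilityMeasure (law x) := hprob x hx
  have hatom : NullSingletonClass (law x) := by rw [(h2.1 x hx).2.2]; infer_instance
  -- As `n / 0 = 0`, a ratio tending to infinity forces `m n ≠ 0`.
  have hmpos : ∀ᶠ n in atTop, 0 < m n := by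
    filter_upwards [hnm.eventually_gt_atTop 0] with n hn
    refine Nat.pos_of_ne_zero fun h => ?_
    simp [h] at hn
  have hmtop := QRGMM.tendsto_cast_atTop_of_one_div hm hmpos
  set U := QRGMM.uniform01 with hU
  set Q := QRGMM.quantile (law x) with hQdef
  have hQm : AEMeasurable Q U := QRGMM.aemeasurable_quantile
  have hQmap : U.map Q = law x := QRGMM.map_quantile
  have hgm : ∀ n, Measurable fun z : Ω × ℝ =>
      QRGMM.generate (m n) (fun j => bhat n j z.1) x z.2 := fun n =>
    QRGMM.measurable_generate (m n) (hbhat n) x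
  have hQsm : AEMeasurable (fun z : Ω × ℝ => Q z.2) (P.prod U) :=
    hQm.comp_quasiMeasurePreserving Measure.quasiMeasurePreserving_snd
  have hQsmap : (P.prod U).map (fun z : Ω × ℝ => Q z.2) = law x := by
    have h := AEMeasurable.map_map_of_aemeasurable (μ := P.prod U) (f := Prod.snd) (g := Q)
      (by rw [measurePreserving_snd.map_eq]; exact hQm) measurable_snd.aemeasurable
    rw [measurePreserving_snd.map_eq, hQmap] at h
    exact h.symm
  set D : ℕ → Ω × ℝ → ℝ := fun n z =>
    min lbar (r * |QRGMM.generate (m n) (fun j => bhat n j z.1) x z.2 - Q z.2|) with hD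
  have hDi : ∀ n, Integrable (D n) (P.prod U) := fun n =>
    QRGMM.integrable_min ((hgm n).aemeasurable.sub hQsm) hr.le hlbar
  have hDnn : ∀ n z, 0 ≤ D n z := fun n z => le_min hlbar (by positivity)
  have hconv : ∀ u ∈ Set.Ioo (0 : ℝ) 1, ∀ δ : ℝ, 0 < δ → Tendsto
      (fun n => P {ω | δ ≤ |QRGMM.generate (m n) (fun j => bhat n j ω) x u - Q u|})
      atTop (𝓝 0) := by
    intro u hu δ hδ
    have hlevel : ∀ k : ℕ → ℕ, Tendsto (fun n => (k n : ℝ) / m n) atTop (𝓝 u) →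
        Tendsto (fun n => P {ω | δ ≤ |inner ℝ (bhat n (k n) ω) x - Q u|}) atTop (𝓝 0) := by
      intro k hk
      rw [hQdef, hQ x hx u hu]
      refine QRGMM.tendsto_measure_le_abs_inner_fit_sub hprob hxs hβ hQ h2 h3 hy hlaw hindep hu hk
        ?_ x hδ
      filter_upwards [hk.eventually_const_lt hu.1, hk.eventually_lt_const hu.2, hmpos]
        with n hn0 hn1 hn2
      have hm0 : (0 : ℝ) < m n := Nat.cast_pos.2 hn2
      refine hfit n (k n) (Finset.mem_Ico.2 ⟨?_, ?_⟩)
      · exact Nat.cast_pos.1 ((div_pos_iff_of_pos_right hm0).1 hn0)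
      · exact Nat.cast_lt.1 ((div_lt_one hm0).1 hn1)
    have hk0 := QRGMM.tendsto_floor_mul_div hmtop hu.1.le
    have hk1 : Tendsto (fun n => ((⌊(m n : ℝ) * u⌋₊ + 1 : ℕ) : ℝ) / m n) atTop (𝓝 u) := by
      simpa [add_div] using hk0.add hm
    have hsum := (hlevel _ hk0).add (hlevel _ hk1)
    rw [add_zero] at hsum
    refine tendsto_of_tendsto_of_tendsto_of_le_of_le' tendsto_const_nhds hsum
      (Eventually.of_forall fun n => zero_le) ?_
    filter_upwards [QRGMM.eventually_abs_interpolate_sub_le hmtop hu] with n hn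
    refine (measure_mono fun ω hω => ?_).trans (measure_union_le _ _)
    exact le_max_iff.1 (hω.out.trans (hn (fun j => inner ℝ (bhat n j ω) x) (Q u)))
  -- The data are integrated out first, at fixed `u`; the resulting functions of `u` are dominated
  -- by `lbar`.
  have hDlim : Tendsto (fun n => ∫ z, D n z ∂(P.prod U)) atTop (𝓝 0) := by
    have hswap : ∀ n, ∫ z, D n z ∂(P.prod U) = ∫ u, ∫ ω, D n (ω, u) ∂P ∂U := fun n =>
      integral_prod_symm _ (hDi n)
    simp only [hswap]
    rw [← integral_zero ℝ ℝ (μ := U)]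
    refine tendsto_integral_of_dominated_convergence (fun _ => lbar)
      (fun n => (hDi n).integral_prod_right.aestronglyMeasurable) (integrable_const _)
      (fun n => ae_of_all _ fun u => ?_) ?_
    · rw [Real.norm_eq_abs, abs_of_nonneg (integral_nonneg fun ω => hDnn n _)]
      have h := integral_mono_of_nonneg (μ := P) (f := fun ω => D n (ω, u)) (g := fun _ => lbar)
        (ae_of_all _ fun ω => hDnn n _) (integrable_const _)
        (ae_of_all _ fun ω => min_le_left _ _)
      simpa using h
    · filter_upwards [ae_restrict_mem measurableSet_Ioo] with u hu
      exact QRGMM.tendsto_integral_min (fun n => (((hgm n).comp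
        (measurable_id.prodMk measurable_const)).sub_const (Q u)).aemeasurable)
        (hconv u hu) hr hlbar
  refine ⟨fun l hl => ?_, ?_, fun n l ω => ?_, ?_, fun ε hε => ?_⟩
  · exact QRGMM.integrable_loss aemeasurable_id (hnonneg x hx) hr.le hl.1
  · filter_upwards [hgen] with n hn l hl
    exact QRGMM.integrable_loss (hgm n).aemeasurable hn hr.le hl.1
  -- For an arbitrary `ω` the outputs may be negative, so the bound comes from the finitely many
  -- grid values.
  · refine Integrable.of_bound ((QRGMM.measurable_loss r l).comp
      (QRGMM.measurable_generate_right (m n) (fun j => bhat n j ω) x)).aestronglyMeasurable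
      (|l| + |r| * ∑ j ∈ Finset.range (m n + 2), |inner ℝ (bhat n j ω) x|) ?_
    filter_upwards [ae_restrict_mem measurableSet_Ioo] with u hu
    refine (QRGMM.abs_loss_le _ _ _).trans ?_
    gcongr
    exact QRGMM.abs_interpolate_le _ _ hu
  · rw [Metric.tendstoUniformlyOn_iff]
    intro ε hε
    filter_upwards [hgen, hDlim.eventually_lt_const hε] with n hn hlt l hl
    rw [dist_comm, Real.dist_eq]
    exact (QRGMM.abs_expectedLoss_sub_le (hgm n).aemeasurable hQsm hQsmap (hnonneg x hx) hn
      hr.le hl).trans_lt hlt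
  · have hbound : Tendsto (fun n => ENNReal.ofReal ((∫ z, D n z ∂(P.prod U)) / ε)) atTop (𝓝 0) := by
      simpa using ENNReal.tendsto_ofReal (hDlim.div_const ε)
    refine tendsto_of_tendsto_of_tendsto_of_le_of_le' tendsto_const_nhds hbound
      (Eventually.of_forall fun n => zero_le) ?_
    filter_upwards [hgen] with n hn
    have hle : P {ω | ∃ l ∈ Set.Icc 0 lbar,
        ε ≤ |QRGMM.expectedLoss U (QRGMM.generate (m n) (fun j => bhat n j ω) x) r l
            - QRGMM.expectedLoss (law x) id r l|} ≤ P {ω | ε ≤ ∫ u, D n (ω, u) ∂U} := by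
      -- Nonnegativity for almost every pair gives, for almost every `ω`, nonnegativity for almost
      -- every `u`.
      refine measure_mono_ae ?_
      filter_upwards [Measure.ae_ae_of_ae_prod hn] with ω hω
      rintro ⟨l, hl, hεl⟩
      exact hεl.trans (QRGMM.abs_expectedLoss_sub_le
        (QRGMM.measurable_generate_right _ _ _).aemeasurable hQm hQmap (hnonneg x hx) hω hr.le hl)
    refine hle.trans ?_
    rw [← ofReal_measureReal]
    refine ENNReal.ofReal_le_ofReal ?_
    rw [le_div_iff₀ hε, mul_comm, integral_prod _ (hDi n)]
    exact mul_meas_ge_le_integral_of_nonneg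
      (ae_of_all _ fun ω => integral_nonneg fun u => hDnn n _) (hDi n).integral_prod_left ε
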